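/- Theorem 1.2. A manifold (of dimension $n\ge 1$) is a Hausdorff space $M$, not assumed metrisable, each of whose points has a neighbourhood homeomorphic to $\mathbb{R}^{n-1}\times\mathbb{R}_{\ge 0}$; its boundary $\partial M$ is the (closed) set of points with no neighbourhood homeomorphic to $\mathbb{R}^n$. A closed subset $B$ of a space $X$ is collared in $X$ if there is a topological embedding $h: B\times[0,1]\to X$ such that $h(x,0)=x$ for all $x\in B$, $h^{-1}(B)=B\times\{0\}$, and $h(B\times[0,1))$ is open in $X$; it is strongly collared if $h$ can moreover be chosen to be a closed map. A space is countably metacompact if every countable open cover has a point-finite open refinement. Let $M$ be a connected manifold with boundary $\partial M$. Then: (a) If $\partial M$ is compact, then it is strongly collared in $M$. (b) If $\partial M$ is Lindelöf, then it is collared in $M$. (c) If $M-\partial M$ is metrisable and $\partial M$ is collared in $M$, then $\partial M$ is Lindelöf. (d) If $M$ is normal and $\partial M$ is countably metacompact and collared in $M$, then $\partial M$ is strongly collared in $M$. If $\partial M$ is metrisable or Lindelöf, then it is countably metacompact. (e) If $M-\partial M$ is metrisable, then the following are equivalent: $\partial M$ is collared in $M$; $\partial M$ is strongly collared in $M$;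 $M$ is metrisable. -/

import Mathlib

open Set Topology

/-- `M` is a (Hausdorff, not necessarily metrisable or connected) topological manifold with
boundary of dimension `n + 1`: each point has a neighbourhood, not required to be open, that is
homeomorphic to the half-space `ℝⁿ × ℝ_{≥ 0}`. -/
structure IsManifoldWithBoundary (n : ℕ) (M : Type*) [TopologicalSpace M] : Prop where
  t2 : T2Space M
  exists_nhds : ∀ x : M, ∃ N ∈ 𝓝 x, Nonempty (N ≃ₜ EuclideanSpace ℝ (Fin n) × Ici (0 : ℝ))

/-- The boundary of an `(n + 1)`-dimensional manifold: the set of points that have no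
neighbourhood homeomorphic to `ℝⁿ⁺¹`. -/
def manifoldBoundary (n : ℕ) (M : Type*) [TopologicalSpace M] : Set M :=
  {x | ¬ ∃ N ∈ 𝓝 x, Nonempty (N ≃ₜ EuclideanSpace ℝ (Fin (n + 1)))}

theorem isClosed_manifoldBoundary (n : ℕ) (M : Type*) [TopologicalSpace M] :
    IsClosed (manifoldBoundary n M) := by
  rw [← isOpen_compl_iff, isOpen_iff_mem_nhds]
  intro x hx
  obtain ⟨N, hN, e⟩ := not_not.1 hx
  filter_upwards [eventually_mem_nhds_iff.2 hN] with y hy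
  exact not_not.2 ⟨N, hy, e⟩

/-- `h : B × [0,1] → X` is a collar of the closed set `B` in `X`: a topological embedding with
`h (x, 0) = x` and `h⁻¹(B) = B × {0}` that sends `B × [0,1)` to an open subset of `X`. -/
structure IsCollar {X : Type*} [TopologicalSpace X] (B : Set X) (h : B × Icc (0 : ℝ) 1 → X) :
    Prop where
  isEmbedding : IsEmbedding h
  apply_zero : ∀ x : B, h (x, 0) = x
  preimage_eq : h ⁻¹' B = {p | p.2 = 0}
  isOpen_image : IsOpen (h '' {p | p.2 < 1})

/-- The closed set `B` is collared in `X`. -/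
def IsCollared {X : Type*} [TopologicalSpace X] (B : Set X) : Prop :=
  ∃ h : B × Icc (0 : ℝ) 1 → X, IsCollar B h

/-- The closed set `B` is strongly collared in `X`: it has a collar that is a closed map. -/
def IsStronglyCollared {X : Type*} [TopologicalSpace X] (B : Set X) : Prop :=
  ∃ h : B × Icc (0 : ℝ) 1 → X, IsCollar B h ∧ IsClosedMap h

/-- A space is countably metacompact if every countable open cover has a point-finite open
refinement. -/
def IsCountablyMetacompact (X : Type*) [TopologicalSpace X] : Prop :=
  ∀ F : Set (Set X), F.Countable → (∀ U ∈ F, IsOpen U) → ⋃₀ F = univ →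
    ∃ G : Set (Set X), (∀ V ∈ G, IsOpen V) ∧ ⋃₀ G = univ ∧ (∀ V ∈ G, ∃ U ∈ F, V ⊆ U) ∧
      ∀ x : X, {V ∈ G | x ∈ V}.Finite

/-!
The collars come from Brown's collaring theorem, proved here along Connelly's lines. Glue an
external collar `B × (-∞, 0]` to `X` along `B`. In the resulting space the points of `B` have charts
`V × ℝ` (`IsCollarChart.extend`). If two functions `F ≥ F' ≥ 0` differ on `B` only inside such a
chart, sliding along the fibres `{v} × ℝ` gives a homeomorphism with compact support in the chart
that takes the part above the graph of `-F` to the part above the graph of `-F'`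
(`IsCollarChart.exists_slide`). Summing locally finitely many bump functions that are together
positive on `B`, one obtains a positive depth `F` and, by composing the slides, an open embedding of
the enlarged space into itself that maps the part above the graph of `-F` into `X` and the graph
onto `B`. The external collar of depth `F` is thereby turned into a collar inside `X`
(`isCollared_of_isOpenEmbedding`, `isCollared_of_bumps`). The construction needs a locally finite
family of charts, hence a locally compact, σ-compact space.

The boundary of a manifold is locally flat without any appeal to invariance of domain: translations
act transitively on the bounding hyperplane of the half-space, so in a chart that contains one
boundary point all points of the hyperplane are boundary points
(`IsManifoldWithBoundary.exists_isCollarChart`).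

A Lindelöf boundary has a second-countable open neighbourhood, where Brown's theorem applies; this
gives a collar, which is a closed map when the boundary is compact. Conversely, if the interior is
metrisable, then, being connected, locally compact and paracompact, it is second countable, and so
is the boundary if it embeds into the interior as a slice of a collar. In that case the manifold is
Lindelöf and locally second countable, hence metrisable. Finally, in a normal space a collar over a
countably metacompact base can be shortened by a continuous positive function, found with the
shrinking lemma for point-finite covers, until its closure lies inside the original collar
(`IsCollared.isStronglyCollared`).
-/

open Set Topology Filter

/-! ### Charts at boundary points -/

open Metric in
/-- Euclidean neighbourhoods can be chosen arbitrarily small: a ball around a point of a Euclidean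
space is itself homeomorphic to the whole space. -/
theorem exists_euclidean_nhds_subset {n : ℕ} {X : Type*} [TopologicalSpace X] {x : X}
    {N O : Set X} (hN : N ∈ 𝓝 x) (φ : N ≃ₜ EuclideanSpace ℝ (Fin n)) (hO : O ∈ 𝓝 x) :
    ∃ N' ∈ 𝓝 x, N' ⊆ O ∧ Nonempty (N' ≃ₜ EuclideanSpace ℝ (Fin n)) := by
  set e₀ := φ ⟨x, mem_of_mem_nhds hN⟩ with he₀
  let ψ : EuclideanSpace ℝ (Fin n) → X := fun v ↦ (φ.symm v : X)
  have hψ : IsEmbedding ψ := IsEmbedding.subtypeVal.comp φ.symm.isEmbedding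
  have hmap : Filter.map ψ (𝓝 e₀) = 𝓝 x := by
    have : Filter.map φ.symm (𝓝 e₀) = 𝓝 ⟨x, mem_of_mem_nhds hN⟩ := by
      rw [φ.symm.map_nhds_eq]; simp [he₀]
    rw [show ψ = Subtype.val ∘ φ.symm from rfl, ← Filter.map_map, this,
      map_nhds_subtype_coe_eq_nhds (mem_of_mem_nhds hN) hN]
  have hO' : ψ ⁻¹' O ∈ 𝓝 e₀ := by rwa [← hmap] at hO
  obtain ⟨ε, hε, hball⟩ := Metric.mem_nhds_iff.1 hO'
  let β := OpenPartialHomeomorph.univBall e₀ ε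
  have hβ : IsOpenEmbedding β := β.isOpenEmbedding (OpenPartialHomeomorph.univBall_source _ _)
  have hβr : range β = ball e₀ ε := by
    rw [← OpenPartialHomeomorph.univBall_target e₀ hε, ← β.image_source_eq_target,
      OpenPartialHomeomorph.univBall_source, image_univ]
  refine ⟨range (ψ ∘ β), ?_, ?_, ⟨(hψ.comp hβ.isEmbedding).toHomeomorph.symm⟩⟩
  · rw [range_comp, hβr, ← hmap]
    exact Filter.image_mem_map (ball_mem_nhds _ hε)
  · rw [range_comp, hβr]
    exact image_subset_iff.2 hball

/-- The boundary is a local notion: open embeddings preserve and reflect it. -/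
theorem Topology.IsOpenEmbedding.mem_manifoldBoundary_iff {n : ℕ} {A X : Type*}
    [TopologicalSpace A] [TopologicalSpace X] {g : A → X} (hg : IsOpenEmbedding g) (a : A) :
    g a ∈ manifoldBoundary n X ↔ a ∈ manifoldBoundary n A := by
  refine not_congr ⟨?_, ?_⟩
  · rintro ⟨N, hN, ⟨φ⟩⟩
    obtain ⟨N', hN', hsub, ⟨φ'⟩⟩ :=
      exists_euclidean_nhds_subset hN φ (hg.isOpen_range.mem_nhds (mem_range_self a))
    refine ⟨g ⁻¹' N', hg.continuous.continuousAt.preimage_mem_nhds hN', ⟨?_⟩⟩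
    exact (hg.isEmbedding.homeomorphImage _).trans
      ((Homeomorph.setCongr (image_preimage_eq_of_subset hsub)).trans φ')
  · rintro ⟨N, hN, ⟨φ⟩⟩
    exact ⟨g '' N, hg.image_mem_nhds.2 hN, ⟨(hg.isEmbedding.homeomorphImage N).symm.trans φ⟩⟩

theorem notMem_manifoldBoundary_halfSpace {n : ℕ} {p : EuclideanSpace ℝ (Fin n) × NNReal}
    (hp : p.2 ≠ 0) : p ∉ manifoldBoundary n (EuclideanSpace ℝ (Fin n) × NNReal) := by
  let c : EuclideanSpace ℝ (Fin n) × ℝ → EuclideanSpace ℝ (Fin n) × NNReal :=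
    fun q ↦ (q.1, ⟨Real.exp q.2, (Real.exp_pos _).le⟩)
  have hc : IsEmbedding c := by
    refine IsEmbedding.of_comp (g := Prod.map id Subtype.val) (by fun_prop) (by fun_prop) ?_
    exact IsEmbedding.id.prodMap Real.isOpenEmbedding_exp.isEmbedding
  have hr : {q : EuclideanSpace ℝ (Fin n) × NNReal | 0 < (q.2 : ℝ)} ⊆ range c :=
    fun q hq ↦ ⟨(q.1, Real.log q.2), Prod.ext rfl (NNReal.eq (Real.exp_log hq))⟩
  have hp' : 0 < (p.2 : ℝ) := NNReal.coe_pos.2 (pos_iff_ne_zero.2 hp)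
  refine not_not.2 ⟨range c, Filter.mem_of_superset
    ((isOpen_lt (f := fun _ ↦ (0 : ℝ)) (g := fun q : EuclideanSpace ℝ (Fin n) × NNReal ↦ (q.2 : ℝ))
      continuous_const (by fun_prop)).mem_nhds hp') hr, ⟨hc.toHomeomorph.symm.trans ?_⟩⟩
  exact (ContinuousLinearEquiv.ofFinrankEq (𝕜 := ℝ) (by simp)).toHomeomorph

/-- Either every point of the bounding hyperplane of the half-space has a Euclidean neighbourhood,
or none has: translations act transitively on the hyperplane. Because of this, invariance of domain
is not needed to locate the boundary in a chart. -/
theorem mem_manifoldBoundary_halfSpace_of_mem {n : ℕ}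
    {p q : EuclideanSpace ℝ (Fin n) × NNReal}
    (hp : p ∈ manifoldBoundary n (EuclideanSpace ℝ (Fin n) × NNReal)) (hq : q.2 = 0) :
    q ∈ manifoldBoundary n (EuclideanSpace ℝ (Fin n) × NNReal) := by
  have hp0 : p.2 = 0 := by
    by_contra h
    exact notMem_manifoldBoundary_halfSpace h hp
  let τ := (Homeomorph.addRight (q.1 - p.1)).prodCongr (Homeomorph.refl (NNReal))
  have : τ p = q := by ext1 <;> simp [τ, hp0, hq]
  rw [← this]
  exact (τ.isOpenEmbedding.mem_manifoldBoundary_iff p).2 hp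

namespace IsManifoldWithBoundary

variable {n : ℕ} {M : Type*} [TopologicalSpace M]

/-- Around each point there is an embedded closed half-space that is a neighbourhood of the point.
The embedding is open at that point, but need not be open elsewhere. -/
theorem exists_embedding (hM : IsManifoldWithBoundary n M) (x : M) :
    ∃ (ψ : EuclideanSpace ℝ (Fin n) × NNReal → M) (p : _), IsEmbedding ψ ∧ ψ p = x ∧
      Filter.map ψ (𝓝 p) = 𝓝 x := by
  obtain ⟨N, hN, ⟨φ⟩⟩ := hM.exists_nhds x
  replace φ : N ≃ₜ EuclideanSpace ℝ (Fin n) × NNReal :=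
    φ.trans ((Homeomorph.refl _).prodCongr (Homeomorph.refl NNReal))
  refine ⟨Subtype.val ∘ φ.symm, φ ⟨x, mem_of_mem_nhds hN⟩,
    IsEmbedding.subtypeVal.comp φ.symm.isEmbedding, by simp, ?_⟩
  rw [← Filter.map_map, φ.symm.map_nhds_eq, φ.symm_apply_apply,
    map_nhds_subtype_coe_eq_nhds (mem_of_mem_nhds hN) hN]

theorem weaklyLocallyCompactSpace (hM : IsManifoldWithBoundary n M) :
    WeaklyLocallyCompactSpace M where
  exists_compact_mem_nhds x := by
    obtain ⟨ψ, p, hψ, -, hmap⟩ := hM.exists_embedding x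
    obtain ⟨K, hK, hKp⟩ := exists_compact_mem_nhds p
    exact ⟨ψ '' K, hK.image hψ.continuous, hmap ▸ Filter.image_mem_map hKp⟩

theorem exists_isOpen_secondCountable (hM : IsManifoldWithBoundary n M) (x : M) :
    ∃ U : Set M, IsOpen U ∧ x ∈ U ∧ SecondCountableTopology U := by
  obtain ⟨ψ, p, hψ, -, hmap⟩ := hM.exists_embedding x
  refine ⟨interior (range ψ), isOpen_interior, mem_interior_iff_mem_nhds.2 ?_, ?_⟩
  · rw [← hmap]
    exact Filter.range_mem_map
  · have : SecondCountableTopology (range ψ) :=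
      hψ.toHomeomorph.symm.isEmbedding.secondCountableTopology
    exact (IsEmbedding.inclusion (interior_subset (s := range ψ))).secondCountableTopology

end IsManifoldWithBoundary

/-- A chart of `X` adapted to `B`: an open embedding of the half-space `V × [0, ∞)` into `X` under
which `B` corresponds to the bounding hyperplane `V × {0}`. -/
structure IsCollarChart {V X : Type*} [TopologicalSpace V] [TopologicalSpace X] (B : Set X)
    (g : V × NNReal → X) : Prop where
  isOpenEmbedding : IsOpenEmbedding g
  mem_iff : ∀ p, g p ∈ B ↔ p.2 = 0

theorem exists_isOpenEmbedding_nnreal_lt {ε : NNReal} (hε : 0 < ε) :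
    ∃ s : NNReal → NNReal, IsOpenEmbedding s ∧ (∀ t, s t = 0 ↔ t = 0) ∧ ∀ t, s t < ε := by
  let s : NNReal → NNReal := fun t ↦ ε * t / (1 + t)
  have hpos : ∀ t : NNReal, 0 < 1 + t := fun t ↦ by positivity
  have hlt : ∀ t, s t < ε := fun t ↦ by
    change ε * t / (1 + t) < ε
    rw [div_lt_iff₀ (hpos t), mul_one_add]
    exact lt_add_of_pos_left _ hε
  have hr : range s = Iio ε := by
    refine Subset.antisymm (range_subset_iff.2 hlt) fun u (hu : u < ε) ↦ ?_
    refine ⟨u / (ε - u), ?_⟩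
    have h : 0 < (ε : ℝ) - u := sub_pos.2 hu
    have : ((ε - u : NNReal) : ℝ) = ε - u := NNReal.coe_sub hu.le
    apply NNReal.eq
    simp only [s, NNReal.coe_div, NNReal.coe_mul, NNReal.coe_add, NNReal.coe_one, this]
    field_simp
    ring
  have hmono : StrictMono s := fun a b hab ↦ by
    change ε * a / (1 + a) < ε * b / (1 + b)
    rw [div_lt_div_iff₀ (hpos a) (hpos b)]
    have : ε * a < ε * b := mul_lt_mul_of_pos_left hab hε
    calc ε * a * (1 + b) = ε * a + ε * a * b := by ring
      _ < ε * b + ε * a * b := by gcongr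
      _ = ε * b * (1 + a) := by ring
  refine ⟨s, ⟨hmono.isEmbedding_of_ordConnected (hr ▸ ordConnected_Iio), hr ▸ isOpen_Iio⟩,
    fun t ↦ ?_, hlt⟩
  simp [s, hε.ne', (hpos t).ne']

open Metric in
theorem IsManifoldWithBoundary.exists_isCollarChart {n : ℕ} {M : Type*} [TopologicalSpace M]
    (hM : IsManifoldWithBoundary n M) {x : M} (hx : x ∈ manifoldBoundary n M) {O : Set M}
    (hO : O ∈ 𝓝 x) :
    ∃ g : EuclideanSpace ℝ (Fin n) × NNReal → M,
      IsCollarChart (manifoldBoundary n M) g ∧ g (0, 0) = x ∧ range g ⊆ O := by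
  obtain ⟨ψ, p, hψ, rfl, hmap⟩ := hM.exists_embedding x
  -- On `D` the embedding `ψ` is open.
  let D : Set (EuclideanSpace ℝ (Fin n) × NNReal) := ψ ⁻¹' interior (range ψ)
  have hD : IsOpen D := isOpen_interior.preimage hψ.continuous
  have hψD : IsOpenEmbedding (ψ ∘ ((↑) : D → _)) := by
    refine ⟨hψ.comp .subtypeVal, ?_⟩
    rw [range_comp, Subtype.range_coe, image_preimage_eq_of_subset interior_subset]
    exact isOpen_interior
  have hmem : ∀ q ∈ D, (ψ q ∈ manifoldBoundary n M ↔
      q ∈ manifoldBoundary n (EuclideanSpace ℝ (Fin n) × NNReal)) := fun q hq ↦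
    (hψD.mem_manifoldBoundary_iff ⟨q, hq⟩).trans
      (hD.isOpenEmbedding_subtypeVal.mem_manifoldBoundary_iff ⟨q, hq⟩).symm
  have hpD : p ∈ D := by
    refine mem_interior_iff_mem_nhds.2 ?_
    rw [← hmap]
    exact Filter.range_mem_map
  have hp := (hmem p hpD).1 hx
  have hp0 : p.2 = 0 := by
    by_contra h
    exact notMem_manifoldBoundary_halfSpace h hp
  have hnhds : D ∩ ψ ⁻¹' O ∈ 𝓝 p :=
    Filter.inter_mem (hD.mem_nhds hpD) (hψ.continuous.continuousAt.preimage_mem_nhds hO)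
  obtain ⟨ε, hε, hball⟩ := Metric.mem_nhds_iff.1 hnhds
  obtain ⟨s, hs, hs0, hsε⟩ := exists_isOpenEmbedding_nnreal_lt (ε := ⟨ε, hε.le⟩) hε
  let β := OpenPartialHomeomorph.univBall p.1 ε
  have hβ : IsOpenEmbedding β := β.isOpenEmbedding (OpenPartialHomeomorph.univBall_source _ _)
  let κ := Prod.map β s
  have hκ : IsOpenEmbedding κ := hβ.prodMap hs
  have hκr : ∀ q, κ q ∈ D ∩ ψ ⁻¹' O := fun q ↦ by
    refine hball ?_
    rw [mem_ball, Prod.dist_eq, max_lt_iff]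
    constructor
    · have : β q.1 ∈ β.target := β.map_source (by simp [β])
      rwa [OpenPartialHomeomorph.univBall_target p.1 hε] at this
    · rw [hp0, NNReal.dist_eq]
      have : ((s q.2 : NNReal) : ℝ) < ε := hsε q.2
      simpa [κ] using this
  refine ⟨ψ ∘ κ, ⟨⟨hψ.comp hκ.isEmbedding, ?_⟩, fun q ↦ ?_⟩, ?_, ?_⟩
  · have : range (ψ ∘ κ) = (ψ ∘ ((↑) : D → _)) '' (Subtype.val ⁻¹' range κ) := by
      rw [image_comp, Subtype.image_preimage_coe, range_comp,
        inter_eq_right.2 (range_subset_iff.2 fun q ↦ (hκr q).1)]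
    rw [this]
    exact hψD.isOpenMap _ (hκ.isOpen_range.preimage continuous_subtype_val)
  · rw [Function.comp_apply, hmem _ (hκr q).1, ← hs0 q.2]
    refine ⟨fun h ↦ ?_, fun h ↦ mem_manifoldBoundary_halfSpace_of_mem hp h⟩
    by_contra h'
    exact notMem_manifoldBoundary_halfSpace (p := κ q) h' h
  · have : κ (0, 0) = p := by
      ext1
      · exact OpenPartialHomeomorph.univBall_apply_zero _ _
      · exact ((hs0 0).2 rfl).trans hp0.symm
    rw [Function.comp_apply, this]
  · exact range_subset_iff.2 fun q ↦ (hκr q).2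

/-! ### Sliding along a line -/

/-- The tent function on `[-3, 1]` with its peak, of height `1`, at `a`. -/
noncomputable def tent (a t : ℝ) : ℝ := max 0 (min ((t + 3) / (a + 3)) ((1 - t) / (1 - a)))

/-- For `a, b ∈ (-3, 1)`, the piecewise linear homeomorphism of the line that is the identity
outside `[-3, 1]` and takes `a` to `b`. -/
noncomputable def slide (a b t : ℝ) : ℝ := t + (b - a) * tent a t

theorem slide_of_le {a b t : ℝ} (ha : -3 < a) (ht : t ≤ -3) : slide a b t = t := by
  have : (t + 3) / (a + 3) ≤ 0 := div_nonpos_of_nonpos_of_nonneg (by linarith) (by linarith)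
  rw [slide, tent, max_eq_left ((min_le_left _ _).trans this)]
  ring

theorem slide_of_ge {a b t : ℝ} (ha : a < 1) (ht : 1 ≤ t) : slide a b t = t := by
  have : (1 - t) / (1 - a) ≤ 0 := div_nonpos_of_nonpos_of_nonneg (by linarith) (by linarith)
  rw [slide, tent, max_eq_left ((min_le_right _ _).trans this)]
  ring

theorem slide_of_mem_left {a b t : ℝ} (ha : -3 < a) (ha' : a < 1) (ht : -3 ≤ t) (hta : t ≤ a) :
    slide a b t = -3 + (t + 3) * ((b + 3) / (a + 3)) := by
  have h3 : 0 < a + 3 := by linarith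
  have h1 : (t + 3) / (a + 3) ≤ 1 := (div_le_one h3).2 (by linarith)
  have h2 : 1 ≤ (1 - t) / (1 - a) := (one_le_div (by linarith)).2 (by linarith)
  have h0 : 0 ≤ (t + 3) / (a + 3) := div_nonneg (by linarith) h3.le
  rw [slide, tent, min_eq_left (h1.trans h2), max_eq_right h0]
  field_simp
  ring

theorem slide_of_mem_right {a b t : ℝ} (ha : -3 < a) (ha' : a < 1) (hat : a ≤ t) (ht : t ≤ 1) :
    slide a b t = 1 - (1 - t) * ((1 - b) / (1 - a)) := by
  have h3 : 0 < 1 - a := by linarith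
  have h1 : (1 - t) / (1 - a) ≤ 1 := (div_le_one h3).2 (by linarith)
  have h2 : 1 ≤ (t + 3) / (a + 3) := (one_le_div (by linarith)).2 (by linarith)
  have h0 : 0 ≤ (1 - t) / (1 - a) := div_nonneg (by linarith) h3.le
  rw [slide, tent, min_eq_right (h1.trans h2), max_eq_right h0]
  field_simp
  ring

theorem slide_slide {a b : ℝ} (ha : -3 < a) (ha' : a < 1) (hb : -3 < b) (hb' : b < 1) (t : ℝ) :
    slide b a (slide a b t) = t := by
  rcases le_total t (-3) with h | h
  · rw [slide_of_le ha h, slide_of_le hb h]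
  rcases le_total 1 t with h' | h'
  · rw [slide_of_ge ha' h', slide_of_ge hb' h']
  rcases le_total t a with hta | hta
  · have ha3 : 0 < a + 3 := by linarith
    have hb3 : 0 < b + 3 := by linarith
    have h1 : (t + 3) / (a + 3) ≤ 1 := (div_le_one ha3).2 (by linarith)
    have h0 : 0 ≤ (t + 3) / (a + 3) := div_nonneg (by linarith) ha3.le
    have e : (t + 3) * ((b + 3) / (a + 3)) = (b + 3) * ((t + 3) / (a + 3)) := by ring
    rw [slide_of_mem_left ha ha' h hta, slide_of_mem_left hb hb' (by rw [e]; nlinarith)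
      (by rw [e]; nlinarith)]
    field_simp
    ring
  · have ha3 : 0 < 1 - a := by linarith
    have hb3 : 0 < 1 - b := by linarith
    have h1 : (1 - t) / (1 - a) ≤ 1 := (div_le_one ha3).2 (by linarith)
    have h0 : 0 ≤ (1 - t) / (1 - a) := div_nonneg (by linarith) ha3.le
    have e : (1 - t) * ((1 - b) / (1 - a)) = (1 - b) * ((1 - t) / (1 - a)) := by ring
    rw [slide_of_mem_right ha ha' hta h', slide_of_mem_right hb hb' (by rw [e]; nlinarith)
      (by rw [e]; nlinarith)]
    field_simp
    ring

theorem slide_self (a t : ℝ) : slide a a t = t := by simp [slide]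

theorem slide_apply_left {a b : ℝ} (ha : -3 < a) (ha' : a < 1) : slide a b a = b := by
  have : a + 3 ≠ 0 := by linarith
  rw [slide_of_mem_left ha ha' ha.le le_rfl]
  field_simp
  ring

theorem le_slide {a b t : ℝ} (ha : -3 < a) (ha' : a < 1) (hb' : b < 1) (h : a ≤ t) :
    b ≤ slide a b t := by
  rcases le_total 1 t with h' | h'
  · rw [slide_of_ge ha' h']
    linarith
  · have ha3 : 0 < 1 - a := by linarith
    have h1 : (1 - t) / (1 - a) ≤ 1 := (div_le_one ha3).2 (by linarith)
    have e : (1 - t) * ((1 - b) / (1 - a)) = (1 - b) * ((1 - t) / (1 - a)) := by ring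
    rw [slide_of_mem_right ha ha' h h', e]
    nlinarith

theorem le_slide_iff {a b t : ℝ} (ha : -3 < a) (ha' : a < 1) (hb : -3 < b) (hb' : b < 1) :
    b ≤ slide a b t ↔ a ≤ t :=
  ⟨fun h ↦ by simpa [slide_slide ha ha' hb hb'] using le_slide hb hb' ha' h,
    le_slide ha ha' hb'⟩

theorem continuous_slide {A : Type*} [TopologicalSpace A] {a b t : A → ℝ} (ha : Continuous a)
    (hb : Continuous b) (ht : Continuous t) (h1 : ∀ x, -3 < a x) (h2 : ∀ x, a x < 1) :
    Continuous fun x ↦ slide (a x) (b x) (t x) := by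
  unfold slide tent
  have h3 : ∀ x, a x + 3 ≠ 0 := fun x ↦ by linarith [h1 x]
  have h4 : ∀ x, 1 - a x ≠ 0 := fun x ↦ by linarith [h2 x]
  fun_prop (disch := assumption)

/-! ### Adding an external collar -/

/-- The space `X` with an external collar `B × (-∞, 0]` glued along `B`, realised as a subspace of
`X × ℝ`: the space `X` itself is the slice at height `0`. -/
def withExternalCollar {X : Type*} (B : Set X) : Set (X × ℝ) := {p | p.2 ≤ 0 ∧ (p.2 < 0 → p.1 ∈ B)}

section Chart

variable {V X : Type*} [TopologicalSpace V] [TopologicalSpace X] {B : Set X} {g : V × NNReal → X}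

theorem IsCollarChart.symm_apply [Nonempty V] (hg : IsCollarChart B g) (q : V × NNReal) :
    (hg.isOpenEmbedding.toOpenPartialHomeomorph g).symm (g q) = q :=
  hg.isOpenEmbedding.toOpenPartialHomeomorph_left_inv g

/-- A collar chart `V × [0, ∞) → X` extends to a chart `V × ℝ` of `X` with its external collar. -/
noncomputable def IsCollarChart.extend [Nonempty V] (hg : IsCollarChart B g) :
    OpenPartialHomeomorph (V × ℝ) (withExternalCollar B) where
  toFun q := ⟨(g (q.1, q.2.toNNReal), min q.2 0), min_le_right _ _, fun h ↦ by
    rw [hg.mem_iff]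
    simpa using (lt_of_not_ge fun h' ↦ by simp_all : q.2 < 0).le⟩
  invFun p :=
    (((hg.isOpenEmbedding.toOpenPartialHomeomorph g).symm p.1.1).1,
      ((hg.isOpenEmbedding.toOpenPartialHomeomorph g).symm p.1.1).2 + p.1.2)
  source := univ
  target := {p | p.1.1 ∈ range g}
  map_source' _ _ := mem_range_self _
  map_target' _ _ := mem_univ _
  left_inv' q _ := by
    ext1
    · simp [hg.symm_apply]
    · simp only [hg.symm_apply, Real.coe_toNNReal']
      rw [max_add_min, add_zero]
  right_inv' p hp := by
    obtain ⟨⟨⟨x, s⟩, hs, hsB⟩, ⟨⟨v, t⟩, hvt⟩⟩ := p, hp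
    change g (v, t) = x at hvt
    subst hvt
    simp only at hs hsB
    rcases hs.lt_or_eq with h | rfl
    · have : t = 0 := (hg.mem_iff _).1 (hsB h)
      subst this
      simp [hs, hg.symm_apply, Real.toNNReal_of_nonpos hs]
    · simp [hg.symm_apply]
  open_source := isOpen_univ
  open_target := hg.isOpenEmbedding.isOpen_range.preimage (by fun_prop)
  continuousOn_toFun := by
    have := hg.isOpenEmbedding.continuous
    exact Continuous.continuousOn (by fun_prop)
  continuousOn_invFun := by
    have h : ContinuousOn (fun p : withExternalCollar B ↦
        (hg.isOpenEmbedding.toOpenPartialHomeomorph g).symm p.1.1) {p | p.1.1 ∈ range g} :=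
      (hg.isOpenEmbedding.toOpenPartialHomeomorph g).continuousOn_symm.comp
        (by fun_prop) fun p hp ↦ by simpa using hp
    fun_prop

end Chart

/-! ### Extending homeomorphisms of a chart by the identity -/

section Extend

variable {E Y : Type*} [TopologicalSpace E] [TopologicalSpace Y]

open Classical in
/-- The extension by the identity of a self-map of the source of a chart `e`. -/
noncomputable def OpenPartialHomeomorph.extendById (e : OpenPartialHomeomorph E Y) (θ : E → E)
    (p : Y) : Y :=
  if p ∈ e.target then e (θ (e.symm p)) else p

theorem OpenPartialHomeomorph.extendById_apply (e : OpenPartialHomeomorph E Y)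
    (he : e.source = univ) (θ : E → E) (q : E) :
    e.extendById θ (e q) = e (θ q) := by
  have hq : q ∈ e.source := he ▸ mem_univ q
  rw [extendById, if_pos (e.map_source hq), e.left_inv hq]

theorem OpenPartialHomeomorph.extendById_of_notMem (e : OpenPartialHomeomorph E Y) {K : Set E}
    {θ : E → E} (hθ : ∀ q ∉ K, θ q = q) {p : Y} (hp : p ∉ e '' K) : e.extendById θ p = p := by
  by_cases h : p ∈ e.target
  · have : e.symm p ∉ K := fun h' ↦ hp ⟨_, h', e.right_inv h⟩
    rw [extendById, if_pos h, hθ _ this, e.right_inv h]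
  · rw [extendById, if_neg h]

theorem OpenPartialHomeomorph.continuous_extendById [T2Space Y] (e : OpenPartialHomeomorph E Y)
    (he : e.source = univ) {K : Set E} (hK : IsCompact K) {θ : E → E} (hθc : Continuous θ)
    (hθ : ∀ q ∉ K, θ q = q) : Continuous (e.extendById θ) := by
  have heK : IsClosed (e '' K) :=
    (hK.image_of_continuousOn (e.continuousOn.mono (he ▸ subset_univ _))).isClosed
  refine continuous_iff_continuousAt.2 fun p ↦ ?_
  by_cases hp : p ∈ e.target
  · have h1 : ContinuousAt (fun p ↦ e (θ (e.symm p))) p :=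
      (e.continuousAt (he ▸ mem_univ _)).comp
        (hθc.continuousAt.comp (e.continuousAt_symm hp))
    refine h1.congr ?_
    filter_upwards [e.open_target.mem_nhds hp] with q hq
    rw [extendById, if_pos hq]
  · have hpK : p ∉ e '' K := fun ⟨q, _, hq⟩ ↦ hp (hq ▸ e.map_source (he ▸ mem_univ q))
    refine continuousAt_id.congr ?_
    filter_upwards [heK.isOpen_compl.mem_nhds hpK] with q hq
    exact (e.extendById_of_notMem hθ hq).symm

/-- A homeomorphism of the source of a chart with compact support extends by the identity. -/
theorem OpenPartialHomeomorph.exists_homeomorph_extend [T2Space Y] (e : OpenPartialHomeomorph E Y)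
    (he : e.source = univ) {K : Set E} (hK : IsCompact K) (θ : E ≃ₜ E) (hθ : ∀ q ∉ K, θ q = q) :
    ∃ Θ : Y ≃ₜ Y, (∀ q, Θ (e q) = e (θ q)) ∧ ∀ p ∉ e '' K, Θ p = p := by
  have hθ' : ∀ q ∉ K, θ.symm q = q := fun q hq ↦ by rw [θ.symm_apply_eq, hθ q hq]
  have hinv : ∀ θ₁ θ₂ : E → E, (∀ q, θ₂ (θ₁ q) = q) → (∀ q ∉ K, θ₁ q = q) → (∀ q ∉ K, θ₂ q = q) →
      Function.LeftInverse (e.extendById θ₂) (e.extendById θ₁) := fun θ₁ θ₂ h h1 h2 p ↦ by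
    by_cases hp : p ∈ e '' K
    · obtain ⟨q, -, rfl⟩ := hp
      rw [e.extendById_apply he, e.extendById_apply he, h]
    · rw [e.extendById_of_notMem h1 hp, e.extendById_of_notMem h2 hp]
  exact ⟨⟨⟨e.extendById θ, e.extendById θ.symm, hinv _ _ θ.symm_apply_apply hθ hθ',
    hinv _ _ θ.apply_symm_apply hθ' hθ⟩, e.continuous_extendById he hK θ.continuous hθ,
    e.continuous_extendById he hK θ.symm.continuous hθ'⟩, e.extendById_apply he θ,
    fun p hp ↦ e.extendById_of_notMem hθ hp⟩

end Extend

/-! ### Pushing a layer of the external collar into a chart -/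

section Slide

variable {V X : Type*} [NormedAddCommGroup V] [TopologicalSpace X]
  {B : Set X} {g : V × NNReal → X}

theorem IsCollarChart.neg_le_min_iff (hg : IsCollarChart B g) {F : X → ℝ} (hF : ∀ x, 0 ≤ F x)
    (q : V × ℝ) :
    -F (hg.extend q).1.1 ≤ (hg.extend q).1.2 ↔ -F (g (q.1, 0)) ≤ q.2 := by
  change -F (g (q.1, q.2.toNNReal)) ≤ min q.2 0 ↔ _
  rcases le_total q.2 0 with h | h
  · rw [Real.toNNReal_of_nonpos h, min_eq_left h]
  · rw [min_eq_right h]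
    exact ⟨fun _ ↦ by linarith [hF (g (q.1, 0))], fun _ ↦ by linarith [hF (g (q.1, q.2.toNNReal))]⟩

/-- If two height functions `F` and `F'` differ on `B` only inside a chart, then some homeomorphism
of the externally collared space, supported in that chart, carries the part above the graph of `-F`
onto the part above the graph of `-F'`, preserving the fibres of the external collar along the
graph. -/
theorem IsCollarChart.exists_slide [ProperSpace V] [T2Space X] (hg : IsCollarChart B g)
    {F F' : X → ℝ} (hF : Continuous F) (hF' : Continuous F')
    (hF0 : ∀ x, 0 ≤ F x) (hF2 : ∀ x, F x ≤ 2) (hF0' : ∀ x, 0 ≤ F' x) (hF2' : ∀ x, F' x ≤ 2)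
    (hFF' : ∀ x ∈ B, F x ≠ F' x → ∃ v, ‖v‖ ≤ 1 ∧ g (v, 0) = x) :
    ∃ Θ : withExternalCollar B ≃ₜ withExternalCollar B,
      (∀ p, Θ p ≠ p → p.1.1 ∈ g '' {q | ‖q.1‖ ≤ 1 ∧ q.2 ≤ 1}) ∧
      (∀ p, -F' (Θ p).1.1 ≤ (Θ p).1.2 ↔ -F p.1.1 ≤ p.1.2) ∧
      ∀ p, p.1.1 ∈ B → p.1.2 = -F p.1.1 → (Θ p).1 = (p.1.1, -F' p.1.1) := by
  have hgB : ∀ v, g (v, 0) ∈ B := fun v ↦ (hg.mem_iff _).2 rfl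
  have hgc := hg.isOpenEmbedding.continuous
  have hlow : ∀ {G : X → ℝ}, (∀ x, G x ≤ 2) → ∀ x, -3 < -G x := fun h x ↦ by linarith [h x]
  have hup : ∀ {G : X → ℝ}, (∀ x, 0 ≤ G x) → ∀ x, -G x < 1 := fun h x ↦ by linarith [h x]
  let θ : V × ℝ ≃ₜ V × ℝ :=
    { toFun := fun q ↦ (q.1, slide (-F (g (q.1, 0))) (-F' (g (q.1, 0))) q.2)
      invFun := fun q ↦ (q.1, slide (-F' (g (q.1, 0))) (-F (g (q.1, 0))) q.2)
      left_inv := fun q ↦ Prod.ext rfl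
        (slide_slide (hlow hF2 _) (hup hF0 _) (hlow hF2' _) (hup hF0' _) _)
      right_inv := fun q ↦ Prod.ext rfl
        (slide_slide (hlow hF2' _) (hup hF0' _) (hlow hF2 _) (hup hF0 _) _)
      continuous_toFun := continuous_fst.prodMk (continuous_slide (by fun_prop) (by fun_prop)
        (by fun_prop) (fun _ ↦ hlow hF2 _) (fun _ ↦ hup hF0 _))
      continuous_invFun := continuous_fst.prodMk (continuous_slide (by fun_prop) (by fun_prop)
        (by fun_prop) (fun _ ↦ hlow hF2' _) (fun _ ↦ hup hF0' _)) }
  let K : Set (V × ℝ) := Metric.closedBall 0 1 ×ˢ Icc (-3) 1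
  have hK : IsCompact K := (isCompact_closedBall 0 1).prod isCompact_Icc
  have hθ : ∀ q ∉ K, θ q = q := fun q hq ↦ by
    refine Prod.ext rfl ?_
    change slide _ _ q.2 = q.2
    by_cases hv : ‖q.1‖ ≤ 1
    · have : ¬ (-3 ≤ q.2 ∧ q.2 ≤ 1) := fun h ↦ hq ⟨by simpa using hv, h⟩
      rcases not_and_or.1 this with h | h
      · exact slide_of_le (hlow hF2 _) (not_le.1 h).le
      · exact slide_of_ge (hup hF0 _) (not_le.1 h).le
    · have : F (g (q.1, 0)) = F' (g (q.1, 0)) := by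
        by_contra h
        obtain ⟨v, hv', hvq⟩ := hFF' _ (hgB _) h
        have : v = q.1 := congrArg Prod.fst (hg.isOpenEmbedding.injective hvq)
        exact hv (this ▸ hv')
      rw [this, slide_self]
  have hsource : hg.extend.source = univ := rfl
  obtain ⟨Θ, hΘe, hΘ⟩ := hg.extend.exists_homeomorph_extend hsource hK θ hθ
  have htarget : ∀ p : withExternalCollar B, p.1.1 ∈ range g → ∃ q, hg.extend q = p := fun p hp ↦
    ⟨_, hg.extend.right_inv (show p ∈ hg.extend.target from hp)⟩
  have hfix : ∀ p : withExternalCollar B, p.1.1 ∉ range g → Θ p = p := fun p hp ↦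
    hΘ p fun ⟨q, _, hq⟩ ↦ hp (hq ▸ mem_range_self _)
  have heq : ∀ x ∈ B, x ∉ range g → F x = F' x := fun x hx hxg ↦ by
    by_contra h
    obtain ⟨v, -, hv⟩ := hFF' x hx h
    exact hxg ⟨_, hv⟩
  refine ⟨Θ, fun p hp ↦ ?_, fun p ↦ ?_, fun p hpB hp ↦ ?_⟩
  · obtain ⟨q, hq, rfl⟩ : p ∈ hg.extend '' K := by
      by_contra h
      exact hp (hΘ p h)
    exact ⟨(q.1, q.2.toNNReal), ⟨by simpa using hq.1, Real.toNNReal_le_one.2 hq.2.2⟩, rfl⟩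
  · by_cases hpg : p.1.1 ∈ range g
    · obtain ⟨q, rfl⟩ := htarget p hpg
      rw [hΘe, hg.neg_le_min_iff hF0', hg.neg_le_min_iff hF0]
      exact le_slide_iff (hlow hF2 _) (hup hF0 _) (hlow hF2' _) (hup hF0' _)
    · rw [hfix p hpg]
      rcases p.2.1.lt_or_eq with h | h
      · rw [heq _ (p.2.2 h) hpg]
      · simp [h, hF0, hF0']
  · by_cases hpg : p.1.1 ∈ range g
    · obtain ⟨⟨v, t⟩, rfl⟩ := htarget p hpg
      have ht : t ≤ 0 := by
        have : t.toNNReal = 0 := (hg.mem_iff _).1 hpB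
        exact Real.toNNReal_eq_zero.1 this
      replace hp : min t 0 = -F (g (v, t.toNNReal)) := hp
      rw [min_eq_left ht, Real.toNNReal_of_nonpos ht] at hp
      have h1 : θ (v, t) = (v, -F' (g (v, 0))) := by
        refine Prod.ext rfl ?_
        change slide _ _ t = _
        rw [hp]
        exact slide_apply_left (hlow hF2 _) (hup hF0 _)
      rw [hΘe, h1]
      change (g (v, (-F' (g (v, 0))).toNNReal), min (-F' (g (v, 0))) 0) =
        (g (v, t.toNNReal), -F' (g (v, t.toNNReal)))
      have h2 : -F' (g (v, 0)) ≤ 0 := neg_nonpos.2 (hF0' _)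
      rw [Real.toNNReal_of_nonpos ht, Real.toNNReal_of_nonpos h2, min_eq_left h2]
    · rw [hfix p hpg, ← heq _ hpB hpg, ← hp]

end Slide

/-! ### Infinite compositions of homeomorphisms -/

/-- The composite `Θ 0 ∘ Θ 1 ∘ ⋯ ∘ Θ (n - 1)`. -/
def iterHomeomorph {Y : Type*} [TopologicalSpace Y] (Θ : ℕ → Y ≃ₜ Y) : ℕ → Y ≃ₜ Y
  | 0 => Homeomorph.refl Y
  | n + 1 => (Θ n).trans (iterHomeomorph Θ n)

/-- If the homeomorphisms `Θ n` have locally finite supports, then the composites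
`Θ 0 ∘ ⋯ ∘ Θ (n - 1)` are locally eventually constant, and their limit is an open embedding.
(It need not be surjective, as the backward orbit of a point may meet infinitely many of the
supports.) -/
theorem exists_isOpenEmbedding_iterHomeomorph {Y : Type*} [TopologicalSpace Y] (Θ : ℕ → Y ≃ₜ Y)
    (hΘ : ∀ p, ∃ N, ∀ᶠ q in 𝓝 p, ∀ m ≥ N, Θ m q = q) :
    ∃ Φ : Y → Y, IsOpenEmbedding Φ ∧
      ∀ p N, (∀ m ≥ N, Θ m p = p) → Φ p = iterHomeomorph Θ N p := by
  have hconst : ∀ p N, (∀ m ≥ N, Θ m p = p) → ∀ m ≥ N,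
      iterHomeomorph Θ m p = iterHomeomorph Θ N p := fun p N hN m hm ↦ by
    induction m, hm using Nat.le_induction with
    | base => rfl
    | succ m hm ih => rw [← ih, iterHomeomorph, Homeomorph.trans_apply, hN m hm]
  choose N hN using hΘ
  let Φ : Y → Y := fun p ↦ iterHomeomorph Θ (N p) p
  have hΦ : ∀ p k, (∀ m ≥ k, Θ m p = p) → Φ p = iterHomeomorph Θ k p := fun p k hk ↦ by
    change iterHomeomorph Θ (N p) p = _
    rw [← hconst p (N p) (hN p).self_of_nhds _ (le_max_left _ k),
      hconst p k hk _ (le_max_right (N p) k)]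
  have hmap : ∀ p, map Φ (𝓝 p) = 𝓝 (Φ p) := fun p ↦ by
    have h : Φ =ᶠ[𝓝 p] iterHomeomorph Θ (N p) := (hN p).mono fun q hq ↦ hΦ q _ hq
    rw [map_congr h, Homeomorph.map_nhds_eq]
  have hinj : Function.Injective Φ := fun p q hpq ↦ by
    have hp := (hN p).self_of_nhds
    have hq := (hN q).self_of_nhds
    rw [hΦ p (max (N p) (N q)) fun m hm ↦ hp m ((le_max_left _ _).trans hm),
      hΦ q (max (N p) (N q)) fun m hm ↦ hq m ((le_max_right _ _).trans hm)] at hpq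
    exact (iterHomeomorph Θ _).injective hpq
  refine ⟨Φ, .of_continuous_injective_isOpenMap ?_ hinj ?_, hΦ⟩
  · exact continuous_iff_continuousAt.2 fun p ↦ (hmap p).le
  · exact isOpenMap_iff_nhds_le.2 fun p ↦ (hmap p).ge

/-! ### Brown's collaring theorem -/

/-- If an open embedding `Φ` of the externally collared space into itself maps the part above the
graph of `-F` to `X` and the graph itself identically to `B`, then it turns the external collar
between `X` and the graph into a collar inside `X`. -/
theorem isCollared_of_isOpenEmbedding {X : Type*} [TopologicalSpace X] {B : Set X} {F : X → ℝ}
    (hF : Continuous F) (hF0 : ∀ x ∈ B, 0 < F x)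
    {Φ : withExternalCollar B → withExternalCollar B} (hΦ : IsOpenEmbedding Φ)
    (hlevel : ∀ p, (Φ p).1.2 = 0 ↔ -F p.1.1 ≤ p.1.2)
    (hgraph : ∀ p, p.1.1 ∈ B → p.1.2 = -F p.1.1 → (Φ p).1 = (p.1.1, 0)) : IsCollared B := by
  -- `j (x, u)` is the point of the external collar over `x` at height `-(1 - u) F x`.
  let j : B × Icc (0 : ℝ) 1 → withExternalCollar B := fun q ↦
    ⟨(q.1, -((1 - q.2) * F q.1)), by
      have h1 : (0 : ℝ) ≤ 1 - q.2 := sub_nonneg.2 q.2.2.2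
      exact neg_nonpos.2 (mul_nonneg h1 (hF0 _ q.1.2).le), fun _ ↦ q.1.2⟩
  have hj : IsEmbedding j := by
    let σ : B × ℝ ≃ₜ B × ℝ :=
      { toFun := fun q ↦ (q.1, -((1 - q.2) * F q.1))
        invFun := fun q ↦ (q.1, 1 + q.2 / F q.1)
        left_inv := fun q ↦ Prod.ext rfl (by
          have := (hF0 _ q.1.2).ne'
          field_simp
          ring)
        right_inv := fun q ↦ Prod.ext rfl (by
          have := (hF0 _ q.1.2).ne'
          field_simp
          ring)
        continuous_toFun := by fun_prop
        continuous_invFun := by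
          have : ∀ q : B × ℝ, F q.1 ≠ 0 := fun q ↦ (hF0 _ q.1.2).ne'
          fun_prop (disch := assumption) }
    refine .of_comp (g := Subtype.val) (by fun_prop) continuous_subtype_val ?_
    exact (IsEmbedding.subtypeVal.prodMap .id).comp
      (σ.isEmbedding.comp (IsEmbedding.id.prodMap .subtypeVal))
  have hjF : ∀ q, -F (j q).1.1 ≤ (j q).1.2 := fun q ↦ by
    change -F q.1 ≤ -((1 - q.2) * F q.1)
    nlinarith [q.2.2.1, hF0 _ q.1.2]
  have hzero : ∀ q, (Φ (j q)).1.2 = 0 := fun q ↦ (hlevel _).2 (hjF q)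
  have hbase : ∀ x : B, (Φ (j (x, 0))).1 = (x.1, 0) := fun x ↦
    hgraph _ x.2 (by simp [j])
  let h : B × Icc (0 : ℝ) 1 → X := fun q ↦ (Φ (j q)).1.1
  let ι : X → withExternalCollar B := fun x ↦ ⟨(x, 0), le_rfl, fun h ↦ (lt_irrefl _ h).elim⟩
  have hι : Continuous ι := by fun_prop
  have hιh : ι ∘ h = Φ ∘ j := funext fun q ↦ Subtype.ext (Prod.ext rfl (hzero q).symm)
  have hΦj : IsEmbedding (Φ ∘ j) := hΦ.isEmbedding.comp hj
  have hh : Continuous h := (continuous_fst.comp continuous_subtype_val).comp hΦj.continuous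
  refine ⟨h, .of_comp hh hι (hιh ▸ hΦj), fun x ↦ congrArg Prod.fst (hbase x), ?_, ?_⟩
  · ext q
    change h q ∈ B ↔ q.2 = 0
    refine ⟨fun hq ↦ ?_, fun hq ↦ ?_⟩
    · have : (Φ ∘ j) (⟨h q, hq⟩, 0) = (Φ ∘ j) q := by
        rw [← hιh]
        have hb : h (⟨h q, hq⟩, 0) = h q := (congrArg Prod.fst (hbase ⟨h q, hq⟩) :)
        exact congrArg ι hb
      exact (congrArg Prod.snd (hΦj.injective this)).symm
    · have : q = (q.1, 0) := Prod.ext rfl hq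
      have hb : h (q.1, 0) = q.1 := congrArg Prod.fst (hbase q.1)
      rw [this, hb]
      exact q.1.2
  · have : h '' {p | p.2 < 1} = ι ⁻¹' (Φ '' {p | p.1.2 < 0}) := by
      ext y
      constructor
      · rintro ⟨q, hq, rfl⟩
        refine ⟨j q, ?_, (congrFun hιh q).symm⟩
        have h1 : (0 : ℝ) < 1 - q.2 := sub_pos.2 hq
        exact neg_neg_of_pos (mul_pos h1 (hF0 _ q.1.2))
      · rintro ⟨p, hp, hpy⟩
        have hpB := p.2.2 hp
        have hF := hF0 _ hpB
        have hpF : -F p.1.1 ≤ p.1.2 := (hlevel p).1 (by rw [hpy])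
        have hp' : p.1.2 < 0 := hp
        have h1 : p.1.2 / F p.1.1 < 0 := div_neg_of_neg_of_pos hp' hF
        have h2 : -1 ≤ p.1.2 / F p.1.1 := (le_div_iff₀ hF).2 (by linarith)
        refine ⟨(⟨p.1.1, hpB⟩, ⟨1 + p.1.2 / F p.1.1, by linarith, by linarith⟩), ?_, ?_⟩
        · exact show 1 + p.1.2 / F p.1.1 < 1 by linarith
        · have : j (⟨p.1.1, hpB⟩, ⟨1 + p.1.2 / F p.1.1, by linarith, by linarith⟩) = p := by
            refine Subtype.ext (Prod.ext rfl ?_)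
            change -((1 - (1 + p.1.2 / F p.1.1)) * F p.1.1) = p.1.2
            field_simp
            ring
          change (Φ (j _)).1.1 = y
          rw [this, hpy]
    rw [this]
    refine (hΦ.isOpenMap _ ?_).preimage hι
    exact isOpen_lt (by fun_prop) continuous_const

/-- A sequence of bump functions `w n` whose traces on `B` are supported in charts and whose chart
images are locally finite yields a collar: starting from the external collar of depth `∑ w n`, the
successive layers of depth `w n` are pushed into `X`, each inside its own chart. -/
theorem isCollared_of_bumps {V X : Type*} [NormedAddCommGroup V] [ProperSpace V]
    [TopologicalSpace X] [T2Space X] {B : Set X} (w : ℕ → X → ℝ) (T : ℕ → Set X)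
    (hw : ∀ n, Continuous (w n)) (hw0 : ∀ n x, 0 ≤ w n x) (hw1 : ∀ n x, w n x ≤ (1 / 2) ^ n)
    (hpos : ∀ x ∈ B, ∃ n, 0 < w n x) (hT : LocallyFinite T)
    (hchart : ∀ n, (∀ x ∈ B, w n x = 0) ∨ ∃ g : V × NNReal → X, IsCollarChart B g ∧
      (∀ x ∈ B, w n x ≠ 0 → ∃ v, ‖v‖ ≤ 1 ∧ g (v, 0) = x) ∧
      g '' {q | ‖q.1‖ ≤ 1 ∧ q.2 ≤ 1} ⊆ T n) : IsCollared B := by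
  have hgeo : Summable fun n : ℕ ↦ (1 / 2 : ℝ) ^ n := summable_geometric_two
  have hsum : ∀ x, Summable fun n ↦ w n x := fun x ↦
    hgeo.of_nonneg_of_le (fun n ↦ hw0 n x) fun n ↦ hw1 n x
  let F : X → ℝ := fun x ↦ ∑' n, w n x
  have hF : Continuous F := continuous_tsum hw hgeo fun n x ↦ by
    rw [Real.norm_of_nonneg (hw0 n x)]
    exact hw1 n x
  let Fn : ℕ → X → ℝ := fun n x ↦ ∑ i ∈ Finset.range n, w i x
  have hFn : ∀ n, Continuous (Fn n) := fun n ↦ continuous_finsetSum _ fun i _ ↦ hw i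
  have hFn0 : ∀ n x, 0 ≤ Fn n x := fun n x ↦ Finset.sum_nonneg fun i _ ↦ hw0 i x
  have hFn2 : ∀ n x, Fn n x ≤ 2 := fun n x ↦
    (Finset.sum_le_sum fun i _ ↦ hw1 i x).trans
      ((hgeo.sum_le_tsum _ fun i _ ↦ by positivity).trans tsum_geometric_two.le)
  have hsucc : ∀ n x, Fn (n + 1) x = Fn n x + w n x := fun n x ↦ Finset.sum_range_succ _ _
  have hslide : ∀ n, ∃ Θ : withExternalCollar B ≃ₜ withExternalCollar B,
      (∀ p, Θ p ≠ p → p.1.1 ∈ T n) ∧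
      (∀ p, -Fn n (Θ p).1.1 ≤ (Θ p).1.2 ↔ -Fn (n + 1) p.1.1 ≤ p.1.2) ∧
      ∀ p, p.1.1 ∈ B → p.1.2 = -Fn (n + 1) p.1.1 → (Θ p).1 = (p.1.1, -Fn n p.1.1) := fun n ↦ by
    rcases hchart n with h | ⟨g, hg, hwg, hgT⟩
    · refine ⟨Homeomorph.refl _, fun p hp ↦ (hp rfl).elim, fun p ↦ ?_, fun p hpB hp ↦ ?_⟩
      · rcases p.2.1.lt_or_eq with hp | hp
        · simp [hsucc, h _ (p.2.2 hp)]
        · simp [hp, hFn0]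
      · rw [hsucc, h _ hpB, add_zero] at hp
        rw [← hp]
        rfl
    · obtain ⟨Θ, h1, h2⟩ := hg.exists_slide (hFn (n + 1)) (hFn n) (hFn0 _) (hFn2 _) (hFn0 _)
        (hFn2 _) fun x hx hne ↦ hwg x hx fun h0 ↦ hne (by rw [hsucc, h0, add_zero])
      exact ⟨Θ, fun p hp ↦ hgT (h1 p hp), h2⟩
  choose Θ hΘT hΘlevel hΘgraph using hslide
  have hTfin : ∀ x, ∃ N, ∀ᶠ y in 𝓝 x, ∀ m ≥ N, y ∉ T m := fun x ↦ by
    obtain ⟨O, hO, hfin⟩ := hT x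
    obtain ⟨N, hN⟩ := hfin.bddAbove
    refine ⟨N + 1, ?_⟩
    filter_upwards [hO] with y hy m hm hym
    have : m ≤ N := hN ⟨y, hym, hy⟩
    omega
  have hΘfix : ∀ {p : withExternalCollar B} {N}, (∀ m ≥ N, p.1.1 ∉ T m) → ∀ m ≥ N, Θ m p = p :=
    fun h m hm ↦ by_contra fun h' ↦ h m hm (hΘT m _ h')
  obtain ⟨Φ, hΦ, hΦN⟩ := exists_isOpenEmbedding_iterHomeomorph Θ fun p ↦ by
    obtain ⟨N, hN⟩ := hTfin p.1.1
    refine ⟨N, ?_⟩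
    have hc : ContinuousAt (fun q : withExternalCollar B ↦ q.1.1) p := by fun_prop
    exact (hc.eventually hN).mono fun q hq ↦ hΘfix hq
  have hiter_level : ∀ n p, 0 ≤ (iterHomeomorph Θ n p).1.2 ↔ -Fn n p.1.1 ≤ p.1.2 := fun n ↦ by
    induction n with
    | zero => simp [iterHomeomorph, Fn]
    | succ n ih =>
      intro p
      rw [iterHomeomorph, Homeomorph.trans_apply, ih, hΘlevel]
  have hiter_graph : ∀ n p, p.1.1 ∈ B → p.1.2 = -Fn n p.1.1 →
      (iterHomeomorph Θ n p).1 = (p.1.1, 0) := fun n ↦ by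
    induction n with
    | zero =>
      intro p _ hp
      refine Prod.ext rfl ?_
      change p.1.2 = 0
      simpa [Fn] using hp
    | succ n ih =>
      intro p hpB hp
      have h := hΘgraph n p hpB hp
      rw [iterHomeomorph, Homeomorph.trans_apply, ih (Θ n p) (by rwa [h]) (by rw [h]), h]
  have hFN : ∀ {x : X} {N}, x ∈ B → (∀ m ≥ N, x ∉ T m) → F x = Fn N x := fun {x N} hx hN ↦ by
    refine tsum_eq_sum fun m hm ↦ ?_
    by_contra hne
    rcases hchart m with h | ⟨g, hg, hwg, hgT⟩
    · exact hne (h x hx)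
    · obtain ⟨v, hv, hvx⟩ := hwg x hx hne
      exact hN m (by simpa using hm) (hgT ⟨(v, 0), ⟨hv, zero_le_one⟩, hvx⟩)
  refine isCollared_of_isOpenEmbedding hF (fun x hx ↦ ?_) hΦ (fun p ↦ ?_) fun p hpB hp ↦ ?_
  · obtain ⟨n, hn⟩ := hpos x hx
    exact (hsum x).tsum_pos (fun i ↦ hw0 i x) n hn
  · obtain ⟨N, hN⟩ := hTfin p.1.1
    have hN := hN.self_of_nhds
    rw [hΦN p N (hΘfix hN)]
    have h1 : (iterHomeomorph Θ N p).1.2 = 0 ↔ 0 ≤ (iterHomeomorph Θ N p).1.2 :=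
      ⟨fun h ↦ h.ge, fun h ↦ le_antisymm (iterHomeomorph Θ N p).2.1 h⟩
    rw [h1, hiter_level]
    rcases p.2.1.lt_or_eq with hp | hp
    · rw [hFN (p.2.2 hp) hN]
    · simp only [hp, Left.neg_nonpos_iff, hFn0, true_iff]
      exact tsum_nonneg fun i ↦ hw0 i _
  · obtain ⟨N, hN⟩ := hTfin p.1.1
    have hN := hN.self_of_nhds
    rw [hΦN p N (hΘfix hN)]
    exact hiter_graph N p hpB (by rw [hp, hFN hpB hN])

section LocallyCollared

variable {V X : Type*} [NormedAddCommGroup V] [ProperSpace V] [TopologicalSpace X] [T2Space X]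
  {B : Set X} {g : V × NNReal → X}

/-- A collar chart carries a bump function that is positive at the points of height zero over the
open unit ball. -/
theorem IsCollarChart.exists_bump (hg : IsCollarChart B g) :
    ∃ w : X → ℝ, Continuous w ∧ (∀ x, 0 ≤ w x) ∧ (∀ x, w x ≤ 1) ∧
      (∀ v, ‖v‖ < 1 → 0 < w (g (v, 0))) ∧ ∀ x ∈ B, w x ≠ 0 → ∃ v, ‖v‖ ≤ 1 ∧ g (v, 0) = x := by
  let e := hg.isOpenEmbedding.toOpenPartialHomeomorph g
  let u : V × NNReal → ℝ := fun q ↦ max 0 (1 - ‖q.1‖ - q.2)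
  have hu : Continuous u := by fun_prop
  have hu0 : ∀ q, 0 ≤ u q := fun q ↦ le_max_left _ _
  have hu1 : ∀ q, u q ≤ 1 := fun q ↦
    max_le zero_le_one (by linarith [norm_nonneg q.1, q.2.coe_nonneg])
  have hune : ∀ q, u q ≠ 0 → ‖q.1‖ ≤ 1 ∧ q.2 ≤ 1 := fun q hq ↦ by
    have : 0 < 1 - ‖q.1‖ - q.2 := by
      by_contra h
      exact hq (max_eq_left (not_lt.1 h))
    refine ⟨by linarith [q.2.coe_nonneg], NNReal.coe_le_coe.1 ?_⟩
    rw [NNReal.coe_one]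
    linarith [norm_nonneg q.1]
  let K : Set (V × NNReal) := Metric.closedBall 0 1 ×ˢ Icc 0 1
  have hK : IsCompact K := (isCompact_closedBall 0 1).prod isCompact_Icc
  have hgK : IsClosed (g '' K) := (hK.image hg.isOpenEmbedding.continuous).isClosed
  let w : X → ℝ := (range g).indicator fun x ↦ u (e.symm x)
  have hwg : ∀ q, w (g q) = u q := fun q ↦ by
    change (range g).indicator _ (g q) = _
    rw [indicator_of_mem (mem_range_self q), hg.symm_apply]
  have hw : ∀ x, (∃ q, g q = x) ∨ w x = 0 := fun x ↦ by
    by_cases h : x ∈ range g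
    · exact Or.inl h
    · exact Or.inr (indicator_of_notMem h _)
  have hwK : ∀ x ∉ g '' K, w x = 0 := fun x hx ↦ by
    by_contra h
    obtain ⟨q, rfl⟩ := (hw x).resolve_right h
    rw [hwg] at h
    exact hx ⟨q, ⟨mem_closedBall_zero_iff.2 (hune q h).1, zero_le, (hune q h).2⟩, rfl⟩
  refine ⟨w, continuous_iff_continuousAt.2 fun x ↦ ?_, fun x ↦ ?_, fun x ↦ ?_, fun v hv ↦ ?_,
    fun x hx hwx ↦ ?_⟩
  · by_cases hx : x ∈ range g
    · have h : ContinuousAt (fun x ↦ u (e.symm x)) x :=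
        hu.continuousAt.comp (e.continuousAt_symm (by simpa [e] using hx))
      refine h.congr ?_
      filter_upwards [hg.isOpenEmbedding.isOpen_range.mem_nhds hx] with y hy
      exact (indicator_of_mem hy fun x ↦ u (e.symm x)).symm
    · refine (continuousAt_const (y := (0 : ℝ))).congr ?_
      filter_upwards [hgK.isOpen_compl.mem_nhds fun h ↦ hx (image_subset_range _ _ h)] with y hy
      exact (hwK y hy).symm
  · rcases hw x with ⟨q, rfl⟩ | h
    · exact (hwg q).symm ▸ hu0 q
    · exact h.ge
  · rcases hw x with ⟨q, rfl⟩ | h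
    · exact (hwg q).symm ▸ hu1 q
    · exact h.trans_le zero_le_one
  · rw [hwg]
    exact lt_max_of_lt_right (by simpa using hv)
  · obtain ⟨⟨v, t⟩, rfl⟩ := (hw x).resolve_right hwx
    rw [hwg] at hwx
    have ht : t = 0 := (hg.mem_iff _).1 hx
    subst ht
    exact ⟨v, (hune _ hwx).1, rfl⟩

/-- **Brown's collaring theorem** for a closed subset of a locally compact, σ-compact Hausdorff
space: if the subset has arbitrarily small collar charts around each of its points, then it is
collared. -/
theorem isCollared_of_forall_exists_isCollarChart [NormedSpace ℝ V] [WeaklyLocallyCompactSpace X]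
    [SigmaCompactSpace X] (hB : IsClosed B)
    (h : ∀ x ∈ B, ∀ O ∈ 𝓝 x, ∃ g : V × NNReal → X, IsCollarChart B g ∧ g (0, 0) = x ∧
      range g ⊆ O) : IsCollared B := by
  let box : (V × NNReal → X) → Set X := fun g ↦ g '' {q | ‖q.1‖ < 1 ∧ q.2 < 1}
  have hbasis : ∀ x ∈ B, (𝓝 x).HasBasis
      (fun g : V × NNReal → X ↦ IsCollarChart B g ∧ g (0, 0) = x) box := fun x hx ↦ by
    refine ⟨fun O ↦ ⟨fun hO ↦ ?_, ?_⟩⟩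
    · obtain ⟨g, hg, hgx, hgO⟩ := h x hx O hO
      exact ⟨g, ⟨hg, hgx⟩, (image_subset_range _ _).trans hgO⟩
    · rintro ⟨g, ⟨hg, rfl⟩, hgO⟩
      have ho : IsOpen {q : V × NNReal | ‖q.1‖ < 1 ∧ q.2 < 1} :=
        (isOpen_lt (continuous_norm.comp continuous_fst) continuous_const).inter
          ((isOpen_Iio (a := (1 : NNReal))).preimage continuous_snd)
      refine mem_of_superset ((hg.isOpenEmbedding.isOpenMap _ ho).mem_nhds ?_) hgO
      exact ⟨(0, 0), by simp, rfl⟩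
  obtain ⟨α, c, r, hr, hcov, hfin⟩ :=
    refinement_of_locallyCompact_sigmaCompact_of_nhds_basis_set hB hbasis
  have hchart : ∀ a, IsCollarChart B (r a) := fun a ↦ (hr a).2.1
  have : Countable α := by
    refine (countable_univ_iff).1 (hfin.countable_univ fun a ↦ ?_)
    exact ⟨_, (0, 0), by simp, rfl⟩
  obtain ⟨code, hcode⟩ := exists_injective_nat α
  choose w hw hw0 hw1 hwpos hwsupp using fun a ↦ (hchart a).exists_bump
  let T : α → Set X := fun a ↦ r a '' {q | ‖q.1‖ ≤ 1 ∧ q.2 ≤ 1}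
  have hTfin : LocallyFinite T := by
    refine hfin.closure.subset fun a ↦ ?_
    have hsub : {q : V × NNReal | ‖q.1‖ ≤ 1 ∧ q.2 ≤ 1} ⊆
        closure {q : V × NNReal | ‖q.1‖ < 1 ∧ q.2 < 1} := by
      have h1 : {q : V × NNReal | ‖q.1‖ < 1 ∧ q.2 < 1} = Metric.ball 0 1 ×ˢ Iio 1 := by
        ext q
        simp
      rw [h1, closure_prod_eq, closure_ball _ one_ne_zero, closure_Iio' ⟨0, zero_lt_one⟩]
      intro q hq
      exact ⟨by simpa using hq.1, hq.2⟩
    exact (image_mono hsub).trans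
      (image_closure_subset_closure_image (hchart a).isOpenEmbedding.continuous)
  -- The charts are enumerated by `code`; the numbers outside its range carry zero bumps.
  let w' : ℕ → X → ℝ := fun n x ↦ (1 / 2) ^ n * Function.extend code (fun a ↦ w a x) 0 n
  let T' : ℕ → Set X := Function.extend code T fun _ ↦ ∅
  have hw'code : ∀ a x, w' (code a) x = (1 / 2) ^ code a * w a x := fun a x ↦ by
    simp only [w', hcode.extend_apply]
  have hw'zero : ∀ n, (¬ ∃ a, code a = n) → ∀ x, w' n x = 0 := fun n hn x ↦ by
    simp only [w', Function.extend_apply' _ _ _ hn, Pi.zero_apply, mul_zero]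
  refine isCollared_of_bumps (V := V) w' T' (fun n ↦ ?_) (fun n x ↦ ?_) (fun n x ↦ ?_)
    (fun x hx ↦ ?_) (fun x ↦ ?_) fun n ↦ ?_
  · by_cases hn : ∃ a, code a = n
    · obtain ⟨a, rfl⟩ := hn
      rw [funext (hw'code a)]
      exact continuous_const.mul (hw a)
    · rw [funext (hw'zero n hn)]
      exact continuous_const
  · by_cases hn : ∃ a, code a = n
    · obtain ⟨a, rfl⟩ := hn
      rw [hw'code]
      exact mul_nonneg (by positivity) (hw0 a x)
    · exact (hw'zero n hn x).ge
  · by_cases hn : ∃ a, code a = n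
    · obtain ⟨a, rfl⟩ := hn
      rw [hw'code]
      exact mul_le_of_le_one_right (by positivity) (hw1 a x)
    · rw [hw'zero n hn]
      positivity
  · obtain ⟨a, ⟨v, t⟩, hvt, rfl⟩ := mem_iUnion.1 (hcov hx)
    have ht : t = 0 := ((hchart a).mem_iff _).1 hx
    subst ht
    exact ⟨code a, by rw [hw'code]; exact mul_pos (by positivity) (hwpos a v hvt.1)⟩
  · obtain ⟨O, hO, hOfin⟩ := hTfin x
    refine ⟨O, hO, (hOfin.image code).subset ?_⟩
    rintro n ⟨y, hyT, hyO⟩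
    by_cases hn : ∃ a, code a = n
    · obtain ⟨a, rfl⟩ := hn
      simp only [T', hcode.extend_apply] at hyT
      exact ⟨a, ⟨y, hyT, hyO⟩, rfl⟩
    · simp only [T', Function.extend_apply' _ _ _ hn] at hyT
      exact hyT.elim
  · by_cases hn : ∃ a, code a = n
    · obtain ⟨a, rfl⟩ := hn
      refine Or.inr ⟨r a, hchart a, fun x hx hne ↦ hwsupp a x hx fun h0 ↦ hne ?_, ?_⟩
      · rw [hw'code, h0, mul_zero]
      · simp only [T', hcode.extend_apply]
        exact subset_rfl
    · exact Or.inl fun x _ ↦ hw'zero n hn x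

end LocallyCollared

theorem isCollared_of_isCollared_preimage_val {X : Type*} [TopologicalSpace X] {B U : Set X}
    (hU : IsOpen U) (hBU : B ⊆ U) (h : IsCollared ((↑) ⁻¹' B : Set U)) : IsCollared B := by
  obtain ⟨h, hh⟩ := h
  let β : B ≃ₜ ((↑) ⁻¹' B : Set U) :=
    { toFun := fun x ↦ ⟨⟨x, hBU x.2⟩, x.2⟩
      invFun := fun x ↦ ⟨x.1.1, x.2⟩
      left_inv := fun _ ↦ rfl
      right_inv := fun _ ↦ rfl
      continuous_toFun := by fun_prop
      continuous_invFun := by fun_prop }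
  let β' := β.prodCongr (Homeomorph.refl (Icc (0 : ℝ) 1))
  refine ⟨fun q ↦ (h (β' q)).1,
    IsEmbedding.subtypeVal.comp (hh.isEmbedding.comp β'.isEmbedding), fun x ↦ ?_, ?_, ?_⟩
  · exact congrArg Subtype.val (hh.apply_zero (β x))
  · ext q
    exact Set.ext_iff.1 hh.preimage_eq (β' q)
  · have : (fun q ↦ (h (β' q)).1) '' {p | p.2 < 1} = (↑) '' (h '' {p | p.2 < 1}) := by
      rw [show (fun q ↦ (h (β' q)).1) = Subtype.val ∘ h ∘ β' from rfl, image_comp, image_comp]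
      congr 2
      ext q
      constructor
      · rintro ⟨p, hp, rfl⟩
        exact hp
      · exact fun hq ↦ ⟨β'.symm q, hq, β'.apply_symm_apply q⟩
    rw [this]
    exact hU.isOpenMap_subtype_val _ hh.isOpen_image

/-! ### Strong collars in normal spaces -/

/-- In a normal, countably metacompact space `Y`, every open neighbourhood of `Y × {0}` in
`Y × [0, 1]` contains the part below the graph of a positive continuous function. -/
theorem exists_continuous_forall_le_mem {Y : Type*} [TopologicalSpace Y] [NormalSpace Y]
    (hY : IsCountablyMetacompact Y) {W : Set (Y × Icc (0 : ℝ) 1)} (hW : IsOpen W)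
    (hW0 : ∀ x, (x, 0) ∈ W) :
    ∃ f : Y → ℝ, Continuous f ∧ (∀ x, 0 < f x) ∧ (∀ x, f x ≤ 1) ∧
      ∀ x (t : Icc (0 : ℝ) 1), (t : ℝ) ≤ f x → (x, t) ∈ W := by
  let U : ℕ → Set Y := fun m ↦
    interior {x | ∀ t : Icc (0 : ℝ) 1, (t : ℝ) ≤ (1 / 2) ^ m → (x, t) ∈ W}
  have hU : ⋃₀ range U = univ := by
    refine eq_univ_of_forall fun x ↦ ?_
    obtain ⟨O, hO, P, hP, hOP⟩ := mem_nhds_prod_iff.1 (hW.mem_nhds (hW0 x))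
    obtain ⟨ε, hε, hPε⟩ := Metric.mem_nhds_iff.1 hP
    obtain ⟨m, hm⟩ := exists_pow_lt_of_lt_one hε (by norm_num : (1 / 2 : ℝ) < 1)
    refine ⟨U m, mem_range_self m, mem_interior_iff_mem_nhds.2 (mem_of_superset hO ?_)⟩
    intro y hy t ht
    refine hOP ⟨hy, hPε ?_⟩
    rw [Metric.mem_ball, Subtype.dist_eq, Real.dist_eq]
    simpa [abs_of_nonneg t.2.1] using ht.trans_lt hm
  obtain ⟨G, hGo, hGcov, hGU, hGfin⟩ := hY (range U) (countable_range U)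
    (forall_mem_range.2 fun _ ↦ isOpen_interior) hU
  have hGU' : ∀ S ∈ G, ∃ m, S ⊆ U m := fun S hS ↦ by
    obtain ⟨_, ⟨m, rfl⟩, hm⟩ := hGU S hS
    exact ⟨m, hm⟩
  choose! k hk using hGU'
  -- Collecting the members of the refinement gives a point-finite cover indexed by `ℕ`.
  let Q : ℕ → Set Y := fun m ↦ ⋃₀ {S ∈ G | k S = m}
  have hQo : ∀ m, IsOpen (Q m) := fun m ↦ isOpen_sUnion fun S hS ↦ hGo S hS.1
  have hQU : ∀ m, Q m ⊆ U m := fun m ↦ sUnion_subset fun S hS ↦ hS.2 ▸ hk S hS.1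
  have hQfin : ∀ x ∈ (univ : Set Y), {m | x ∈ Q m}.Finite := fun x _ ↦ by
    refine ((hGfin x).image k).subset ?_
    rintro m ⟨S, hS, hx⟩
    exact ⟨S, ⟨hS.1, hx⟩, hS.2⟩
  have hQcov : univ ⊆ ⋃ m, Q m := fun x hx ↦ by
    obtain ⟨S, hS, hxS⟩ := hGcov.symm ▸ hx
    exact mem_iUnion.2 ⟨k S, S, ⟨hS, rfl⟩, hxS⟩
  obtain ⟨C, hCcov, hCc, hCQ⟩ := exists_subset_iUnion_closed_subset isClosed_univ hQo hQfin hQcov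
  choose b hb0 hb1 hb using fun m ↦ exists_continuous_zero_one_of_isClosed
    (hQo m).isClosed_compl (hCc m) (disjoint_compl_left_iff_subset.2 (hCQ m))
  have hterm0 : ∀ m x, 0 ≤ (1 / 2 : ℝ) ^ (m + 1) * b m x := fun m x ↦
    mul_nonneg (by positivity) (hb m x).1
  have hterm : ∀ m x, (1 / 2 : ℝ) ^ (m + 1) * b m x ≤ (1 / 2) ^ (m + 1) := fun m x ↦
    mul_le_of_le_one_right (by positivity) (hb m x).2
  have hgeo : Summable fun m : ℕ ↦ (1 / 2 : ℝ) ^ (m + 1) :=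
    (summable_nat_add_iff 1).2 summable_geometric_two
  have hsum : ∀ x, Summable fun m ↦ (1 / 2 : ℝ) ^ (m + 1) * b m x := fun x ↦
    hgeo.of_nonneg_of_le (fun m ↦ hterm0 m x) fun m ↦ hterm m x
  have htail : ∀ m : ℕ, ∑' i : ℕ, (1 / 2 : ℝ) ^ (i + m + 1) = (1 / 2) ^ m := fun m ↦ by
    have : ∀ i : ℕ, (1 / 2 : ℝ) ^ (i + m + 1) = (1 / 2) ^ i * (1 / 2) ^ (m + 1) := fun i ↦ by ring
    simp_rw [this]
    rw [tsum_mul_right, tsum_geometric_two]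
    ring
  -- If `m` is the first index with `x ∈ Q m`, the sum is at most the tail `2⁻ᵐ` of the series.
  have hbound : ∀ x, ∃ m, x ∈ Q m ∧ ∑' i, (1 / 2 : ℝ) ^ (i + 1) * b i x ≤ (1 / 2) ^ m := fun x ↦ by
    classical
    have hx : ∃ m, x ∈ Q m := mem_iUnion.1 (hQcov (mem_univ x))
    obtain ⟨m, hm, hmin⟩ : ∃ m, x ∈ Q m ∧ ∀ i < m, x ∉ Q i :=
      ⟨Nat.find hx, Nat.find_spec hx, fun i hi ↦ Nat.find_min hx hi⟩
    refine ⟨m, hm, ?_⟩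
    rw [← (hsum x).sum_add_tsum_nat_add m, Finset.sum_eq_zero, zero_add, ← htail]
    · exact ((summable_nat_add_iff m).2 (hsum x)).tsum_le_tsum (fun i ↦ hterm (i + m) x)
        ((summable_nat_add_iff (f := fun k : ℕ ↦ (1 / 2 : ℝ) ^ (k + 1)) m).2 hgeo)
    · intro i hi
      rw [hb0 i (hmin i (Finset.mem_range.1 hi)), Pi.zero_apply, mul_zero]
  refine ⟨fun x ↦ ∑' m, (1 / 2 : ℝ) ^ (m + 1) * b m x, ?_, fun x ↦ ?_, fun x ↦ ?_, fun x t ht ↦ ?_⟩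
  · refine continuous_tsum (fun m ↦ by fun_prop) hgeo fun m x ↦ ?_
    rw [Real.norm_of_nonneg (hterm0 m x)]
    exact hterm m x
  · obtain ⟨m, hm⟩ := mem_iUnion.1 (hCcov (mem_univ x))
    refine (hsum x).tsum_pos (fun i ↦ hterm0 i x) m ?_
    rw [hb1 m hm]
    simp
  · obtain ⟨m, -, hm⟩ := hbound x
    exact hm.trans (pow_le_one₀ (by norm_num) (by norm_num))
  · obtain ⟨m, hxm, hm⟩ := hbound x
    exact interior_subset (hQU m hxm) t (ht.trans hm)

/-- Shortening a collar until its closure lies inside the original collar makes it strong. -/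
theorem IsCollared.isStronglyCollared {X : Type*} [TopologicalSpace X] [NormalSpace X] {B : Set X}
    (hB : IsClosed B) (hBm : IsCountablyMetacompact B) (h : IsCollared B) :
    IsStronglyCollared B := by
  obtain ⟨h, hh⟩ := h
  have : NormalSpace B := hB.isClosedEmbedding_subtypeVal.normalSpace
  have hBV : B ⊆ h '' {p | p.2 < 1} := fun x hx ↦
    ⟨(⟨x, hx⟩, 0), show (0 : Icc (0 : ℝ) 1) < 1 from zero_lt_one, hh.apply_zero ⟨x, hx⟩⟩
  obtain ⟨W, hWo, hBW, hWV⟩ := normal_exists_closure_subset hB hh.isOpen_image hBV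
  obtain ⟨f, hf, hf0, hf1, hfW⟩ := exists_continuous_forall_le_mem hBm
    (hWo.preimage hh.isEmbedding.continuous) fun x ↦ by
      rw [mem_preimage, hh.apply_zero]
      exact hBW x.2
  have hle : ∀ q : B × Icc (0 : ℝ) 1, q.2 * f q.1 ≤ f q.1 := fun q ↦
    mul_le_of_le_one_left (hf0 _).le q.2.2.2
  let σ : B × Icc (0 : ℝ) 1 → B × Icc (0 : ℝ) 1 := fun q ↦
    (q.1, ⟨q.2 * f q.1, mul_nonneg q.2.2.1 (hf0 _).le, (hle q).trans (hf1 _)⟩)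
  have hσ : IsClosedEmbedding σ := by
    let τ : B × ℝ ≃ₜ B × ℝ :=
      { toFun := fun q ↦ (q.1, q.2 * f q.1)
        invFun := fun q ↦ (q.1, q.2 / f q.1)
        left_inv := fun q ↦ Prod.ext rfl (mul_div_cancel_right₀ _ (hf0 _).ne')
        right_inv := fun q ↦ Prod.ext rfl (div_mul_cancel₀ _ (hf0 _).ne')
        continuous_toFun := by fun_prop
        continuous_invFun := by
          have : ∀ q : B × ℝ, f q.1 ≠ 0 := fun q ↦ (hf0 _).ne'
          fun_prop (disch := assumption) }
    have hι : IsClosedEmbedding (Prod.map id (↑) : B × Icc (0 : ℝ) 1 → B × ℝ) :=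
      IsClosedEmbedding.id.prodMap isClosed_Icc.isClosedEmbedding_subtypeVal
    exact .of_comp hι.isEmbedding (τ.isClosedEmbedding.comp hι)
  have himage : ∀ {A : Set (B × Icc (0 : ℝ) 1)}, h '' (σ '' A) ⊆ W := by
    rintro _ _ ⟨_, ⟨q, -, rfl⟩, rfl⟩
    exact hfW q.1 _ (hle q)
  refine ⟨h ∘ σ, ⟨hh.isEmbedding.comp hσ.isEmbedding, fun x ↦ ?_, ?_, ?_⟩, fun C hC ↦ ?_⟩
  · have : σ (x, 0) = (x, 0) := Prod.ext rfl (Subtype.ext (zero_mul _))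
    rw [Function.comp_apply, this, hh.apply_zero]
  · rw [preimage_comp, hh.preimage_eq]
    ext q
    change (σ q).2 = 0 ↔ q.2 = 0
    rw [Subtype.ext_iff, Subtype.ext_iff]
    change q.2 * f q.1 = 0 ↔ (q.2 : ℝ) = 0
    simp [(hf0 _).ne']
  · have hσimage : σ '' {q | q.2 < 1} = {q | (q.2 : ℝ) < f q.1} := by
      ext q
      constructor
      · rintro ⟨q, hq, rfl⟩
        exact mul_lt_of_lt_one_left (hf0 _) hq
      · intro hq
        have h1 : (q.2 : ℝ) / f q.1 < 1 := (div_lt_one (hf0 _)).2 hq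
        exact ⟨(q.1, ⟨q.2 / f q.1, div_nonneg q.2.2.1 (hf0 _).le, h1.le⟩), h1,
          Prod.ext rfl (Subtype.ext (div_mul_cancel₀ _ (hf0 _).ne'))⟩
    have hopen : IsOpen {q : B × Icc (0 : ℝ) 1 | (q.2 : ℝ) < f q.1} :=
      isOpen_lt (by fun_prop) (by fun_prop)
    obtain ⟨O, hO, hOh⟩ := hh.isEmbedding.isOpen_iff.1 hopen
    have : h '' {q | (q.2 : ℝ) < f q.1} = O ∩ h '' {q | q.2 < 1} := by
      rw [← hOh, ← image_preimage_inter, hOh]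
      refine congrArg _ (inter_eq_left.2 fun q hq ↦ ?_).symm
      exact lt_of_lt_of_le hq (hf1 q.1)
    rw [image_comp, hσimage, this]
    exact hO.inter hh.isOpen_image
  · obtain ⟨Z, hZ, hZh⟩ := hh.isEmbedding.isClosed_iff.1 (hσ.isClosedMap C hC)
    rw [image_comp]
    refine isClosed_of_closure_subset fun y hy ↦ ?_
    obtain ⟨q, -, rfl⟩ := hWV (closure_mono himage hy)
    refine mem_image_of_mem h ?_
    rw [← hZh]
    refine hZ.closure_subset_iff.2 ?_ hy
    rw [← hZh]
    exact image_preimage_subset h Z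

/-! ### Countability of connected, locally compact spaces -/

theorem ParacompactSpace.isCountablyMetacompact {X : Type*} [TopologicalSpace X]
    [ParacompactSpace X] : IsCountablyMetacompact X := by
  intro F _ hFo hF
  obtain ⟨v, hvo, hvcov, hvfin, hvF⟩ := precise_refinement (fun S : F ↦ S.1)
    (fun S ↦ hFo S S.2) (by rw [← sUnion_eq_iUnion, hF])
  refine ⟨range v, forall_mem_range.2 hvo, by rwa [sUnion_range],
    forall_mem_range.2 fun S ↦ ⟨S, S.2, hvF S⟩, fun x ↦ ?_⟩
  refine ((hvfin.point_finite x).image v).subset ?_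
  rintro _ ⟨⟨S, rfl⟩, hx⟩
  exact ⟨S, hx, rfl⟩

/-- A connected, paracompact, locally compact space is σ-compact: in a locally finite cover by
relatively compact open sets each member meets only finitely many others, so only countably many
members can be reached from a given one along chains of intersecting members. -/
theorem sigmaCompactSpace_of_preconnectedSpace (X : Type*) [TopologicalSpace X]
    [PreconnectedSpace X] [ParacompactSpace X] [WeaklyLocallyCompactSpace X] :
    SigmaCompactSpace X := by
  choose K hK hKx using fun x : X ↦ exists_compact_mem_nhds x
  obtain ⟨v, hvo, hvcov, hvfin, hvK⟩ := precise_refinement (fun x ↦ interior (K x))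
    (fun _ ↦ isOpen_interior)
    (eq_univ_of_forall fun x ↦ mem_iUnion.2 ⟨x, mem_interior_iff_mem_nhds.2 (hKx x)⟩)
  have hfin : ∀ i, {j | (v j ∩ K i).Nonempty}.Finite := fun i ↦
    hvfin.finite_nonempty_inter_compact (hK i)
  rcases isEmpty_or_nonempty X with hX | ⟨⟨x₀⟩⟩
  · exact ⟨⟨fun _ ↦ ∅, fun _ ↦ isCompact_empty, Subsingleton.elim _ _⟩⟩
  let A : ℕ → Set X := fun n ↦ n.rec {i | x₀ ∈ v i} fun _ S ↦ ⋃ i ∈ S, {j | (v j ∩ K i).Nonempty}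
  have hA : ∀ n, (A n).Countable := fun n ↦ by
    induction n with
    | zero => exact (hvfin.point_finite x₀).countable
    | succ n ih => exact ih.biUnion fun i _ ↦ (hfin i).countable
  have hcA : (⋃ n, A n).Countable := countable_iUnion hA
  have hstep : ∀ i ∈ ⋃ n, A n, ∀ j, (v j ∩ K i).Nonempty → j ∈ ⋃ n, A n := fun i hi j hj ↦ by
    obtain ⟨n, hn⟩ := mem_iUnion.1 hi
    exact mem_iUnion.2 ⟨n + 1, mem_biUnion hn hj⟩
  have hclopen : IsClopen (⋃ i ∈ ⋃ n, A n, v i) := by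
    refine ⟨⟨?_⟩, isOpen_biUnion fun i _ ↦ hvo i⟩
    have : (⋃ i ∈ ⋃ n, A n, v i)ᶜ = ⋃ j ∈ (⋃ n, A n)ᶜ, v j := by
      ext x
      simp only [mem_compl_iff, mem_iUnion₂, not_exists, exists_prop]
      constructor
      · intro hx
        obtain ⟨j, hj⟩ := iUnion_eq_univ_iff.1 hvcov x
        exact ⟨j, fun hjA ↦ hx j ⟨hjA, hj⟩, hj⟩
      · rintro ⟨j, hjA, hj⟩ i ⟨hi, hxi⟩
        exact hjA (hstep i hi j ⟨x, hj, interior_subset (hvK i hxi)⟩)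
    rw [this]
    exact isOpen_biUnion fun j _ ↦ hvo j
  have huniv : ⋃ i ∈ ⋃ n, A n, v i = univ := by
    refine hclopen.eq_univ ?_
    obtain ⟨i, hi⟩ := iUnion_eq_univ_iff.1 hvcov x₀
    exact ⟨x₀, mem_biUnion (mem_iUnion.2 ⟨0, hi⟩) hi⟩
  refine isSigmaCompact_univ_iff.1 ?_
  rw [show (univ : Set X) = ⋃ i ∈ ⋃ n, A n, K i from (univ_subset_iff.1 ?_).symm]
  · exact isSigmaCompact_biUnion hcA fun i _ ↦ (hK i).isSigmaCompact
  · rw [← huniv]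
    exact iUnion₂_mono fun i _ ↦ (hvK i).trans interior_subset

/-- A Lindelöf set in a locally second-countable space has a second-countable open
neighbourhood. -/
theorem IsLindelof.exists_isOpen_secondCountable {X : Type*} [TopologicalSpace X] {S : Set X}
    (hS : IsLindelof S)
    (hX : ∀ x : X, ∃ U : Set X, IsOpen U ∧ x ∈ U ∧ SecondCountableTopology U) :
    ∃ U : Set X, IsOpen U ∧ S ⊆ U ∧ SecondCountableTopology U := by
  choose U hUo hxU hU using hX
  obtain ⟨t, ht, hSt⟩ := hS.elim_nhds_subcover U fun x _ ↦ (hUo x).mem_nhds (hxU x)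
  refine ⟨⋃ x ∈ t, U x, isOpen_biUnion fun x _ ↦ hUo x, hSt.2, ?_⟩
  have : Countable t := ht
  have hU' : ∀ x : t, SecondCountableTopology ((↑) ⁻¹' U x : Set ↥(⋃ x ∈ t, U x)) := fun x ↦ by
    have hρ : IsEmbedding fun y : ((↑) ⁻¹' U x : Set ↥(⋃ x ∈ t, U x)) ↦ (y.1.1 : X) :=
      IsEmbedding.subtypeVal.comp .subtypeVal
    have := hU x
    exact (hρ.codRestrict (U x) fun y ↦ y.2).secondCountableTopology
  refine TopologicalSpace.secondCountableTopology_of_countable_cover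
    (fun x : t ↦ (hUo x).preimage continuous_subtype_val) ?_
  refine eq_univ_of_forall fun ⟨y, hy⟩ ↦ ?_
  obtain ⟨x, hx, hyx⟩ := mem_iUnion₂.1 hy
  exact mem_iUnion.2 ⟨⟨x, hx⟩, hyx⟩

/-! ### Interior and boundary of a connected manifold -/

namespace IsManifoldWithBoundary

variable {n : ℕ} {M : Type*} [TopologicalSpace M]

/-- A connected manifold has a connected interior: near a boundary point the interior is, in a
chart, an open half-space, so a separation of the interior would extend to its closure. -/
theorem isPreconnected_compl_manifoldBoundary [PreconnectedSpace M]
    (hM : IsManifoldWithBoundary n M) : IsPreconnected (manifoldBoundary n M)ᶜ := by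
  set s := (manifoldBoundary n M)ᶜ with hs
  have hso : IsOpen s := (isClosed_manifoldBoundary n M).isOpen_compl
  have hchart : ∀ x ∉ s, ∃ O P : Set M, IsOpen O ∧ x ∈ O ∧ O ∩ s = P ∧ IsPreconnected P ∧
      x ∈ closure P := fun x hx ↦ by
    obtain ⟨g, hg, hgx, -⟩ := hM.exists_isCollarChart (not_not.1 hx) univ_mem
    let H : Set (EuclideanSpace ℝ (Fin n) × NNReal) := univ ×ˢ Ioi 0
    have hH : IsPreconnected H := isPreconnected_univ.prod isPreconnected_Ioi
    refine ⟨range g, g '' H, hg.isOpenEmbedding.isOpen_range, ⟨_, hgx⟩, ?_,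
      hH.image g hg.isOpenEmbedding.continuous.continuousOn, ?_⟩
    · ext y
      constructor
      · rintro ⟨⟨q, rfl⟩, hq⟩
        exact ⟨q, ⟨mem_univ _, pos_iff_ne_zero.2 fun h ↦ hq ((hg.mem_iff q).2 h)⟩, rfl⟩
      · rintro ⟨q, hq, rfl⟩
        exact ⟨mem_range_self q, fun h ↦ (ne_of_gt hq.2) ((hg.mem_iff q).1 h)⟩
    · rw [← hgx]
      refine image_closure_subset_closure_image hg.isOpenEmbedding.continuous ⟨(0, 0), ?_, rfl⟩
      rw [closure_prod_eq, closure_Ioi]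
      exact ⟨subset_closure (mem_univ _), self_mem_Ici⟩
  refine isPreconnected_iff_subset_of_disjoint.2 fun u v hu hv hsuv hd ↦ ?_
  have hdis : Disjoint (s ∩ u) (s ∩ v) := by
    rw [disjoint_iff_inter_eq_empty, ← hd]
    ext x
    simp only [mem_inter_iff]
    tauto
  have hunion : closure (s ∩ u) ∪ closure (s ∩ v) = univ := by
    rw [← closure_union, ← inter_union_distrib_left, inter_eq_left.2 hsuv]
    refine eq_univ_of_forall fun x ↦ ?_
    by_cases hx : x ∈ s
    · exact subset_closure hx
    · obtain ⟨O, P, -, -, hP, -, hxP⟩ := hchart x hx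
      exact closure_mono (hP ▸ inter_subset_right) hxP
  have hclosure : Disjoint (closure (s ∩ u)) (closure (s ∩ v)) := by
    refine Set.disjoint_left.2 fun x hxu hxv ↦ ?_
    by_cases hx : x ∈ s
    · rcases hsuv hx with h | h
      · exact Set.disjoint_left.1 (hdis.closure_right (hso.inter hu)) ⟨hx, h⟩ hxv
      · exact Set.disjoint_left.1 (hdis.closure_left (hso.inter hv)) hxu ⟨hx, h⟩
    · obtain ⟨O, P, hO, hxO, hP, hPc, -⟩ := hchart x hx
      have hPs : P ⊆ s := hP ▸ inter_subset_right
      obtain ⟨y, hyO, hys, hyu⟩ := mem_closure_iff.1 hxu O hO hxO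
      obtain ⟨z, hzO, hzs, hzv⟩ := mem_closure_iff.1 hxv O hO hxO
      have hPd : P ∩ (u ∩ v) = ∅ :=
        subset_empty_iff.1 (hd ▸ inter_subset_inter_left _ hPs)
      rcases isPreconnected_iff_subset_of_disjoint.1 hPc u v hu hv (hPs.trans hsuv) hPd with h | h
      · exact Set.disjoint_left.1 hdis ⟨hzs, h (hP ▸ ⟨hzO, hzs⟩)⟩ ⟨hzs, hzv⟩
      · exact Set.disjoint_left.1 hdis ⟨hys, hyu⟩ ⟨hys, h (hP ▸ ⟨hyO, hys⟩)⟩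
  have hcompl : closure (s ∩ u) = (closure (s ∩ v))ᶜ :=
    (IsCompl.of_eq hclosure.inter_eq hunion).eq_compl
  have hclopen : IsClopen (closure (s ∩ u)) :=
    ⟨isClosed_closure, hcompl ▸ isClosed_closure.isOpen_compl⟩
  rcases isClopen_iff.1 hclopen with h | h
  · refine Or.inr fun x hx ↦ (hsuv hx).resolve_left fun hxu ↦ ?_
    exact (h ▸ subset_closure ⟨hx, hxu⟩ : x ∈ (∅ : Set M))
  · refine Or.inl fun x hx ↦ (hsuv hx).resolve_right fun hxv ↦ ?_
    exact Set.disjoint_left.1 hclosure (h ▸ mem_univ x) (subset_closure ⟨hx, hxv⟩)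

/-- A metrisable interior of a connected manifold is Lindelöf, being connected, locally compact and
paracompact. -/
theorem isLindelof_compl_manifoldBoundary [PreconnectedSpace M] (hM : IsManifoldWithBoundary n M)
    (hmet : TopologicalSpace.MetrizableSpace ↥(manifoldBoundary n M)ᶜ) :
    IsLindelof (manifoldBoundary n M)ᶜ := by
  have := hM.t2
  have := hM.weaklyLocallyCompactSpace
  have := (isClosed_manifoldBoundary n M).isOpen_compl.locallyCompactSpace
  have := Subtype.preconnectedSpace hM.isPreconnected_compl_manifoldBoundary
  let _ := TopologicalSpace.metrizableSpaceMetric ↥(manifoldBoundary n M)ᶜ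
  have := sigmaCompactSpace_of_preconnectedSpace ↥(manifoldBoundary n M)ᶜ
  exact isLindelof_iff_lindelofSpace.2 inferInstance

/-- A Lindelöf boundary has a second-countable open neighbourhood, to which Brown's theorem
applies; the manifold itself need not even be normal. -/
theorem isCollared_of_isLindelof (hM : IsManifoldWithBoundary n M)
    (hB : IsLindelof (manifoldBoundary n M)) : IsCollared (manifoldBoundary n M) := by
  have := hM.t2
  have := hM.weaklyLocallyCompactSpace
  obtain ⟨U, hU, hBU, hU2⟩ := hB.exists_isOpen_secondCountable hM.exists_isOpen_secondCountable
  have := hU.locallyCompactSpace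
  refine isCollared_of_isCollared_preimage_val hU hBU ?_
  refine isCollared_of_forall_exists_isCollarChart (V := EuclideanSpace ℝ (Fin n))
    ((isClosed_manifoldBoundary n M).preimage continuous_subtype_val) fun x hx O hO ↦ ?_
  obtain ⟨g, hg, hgx, hgO⟩ :=
    hM.exists_isCollarChart hx (hU.isOpenMap_subtype_val.image_mem_nhds hO)
  have hgU : ∀ q, ∃ y ∈ O, (y : M) = g q := fun q ↦ hgO (mem_range_self q)
  refine ⟨fun q ↦ ⟨g q, by obtain ⟨y, -, hy⟩ := hgU q; exact hy ▸ y.2⟩, ⟨?_, fun q ↦ hg.mem_iff q⟩,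
    Subtype.ext hgx, ?_⟩
  · exact .of_comp _ hU.isOpenEmbedding_subtypeVal hg.isOpenEmbedding
  · rintro _ ⟨q, rfl⟩
    obtain ⟨y, hyO, hy⟩ := hgU q
    have hyq : y = ⟨g q, hy ▸ y.2⟩ := Subtype.ext hy
    change (⟨g q, hy ▸ y.2⟩ : U) ∈ O
    exact hyq ▸ hyO

/-- A collar embeds the boundary into the interior, as its slice at height `1 / 2`. -/
theorem isLindelof_manifoldBoundary_of_isCollared (hM : IsManifoldWithBoundary n M)
    (hint : IsLindelof (manifoldBoundary n M)ᶜ) (hc : IsCollared (manifoldBoundary n M)) :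
    IsLindelof (manifoldBoundary n M) := by
  obtain ⟨h, hh⟩ := hc
  obtain ⟨U, -, hU, hU2⟩ := hint.exists_isOpen_secondCountable hM.exists_isOpen_secondCountable
  let c : Icc (0 : ℝ) 1 := ⟨1 / 2, by norm_num, by norm_num⟩
  have hc : c ≠ 0 := fun h0 ↦ by
    have : (1 / 2 : ℝ) = 0 := congrArg Subtype.val h0
    norm_num at this
  have hslice : IsEmbedding fun x : manifoldBoundary n M ↦ h (x, c) :=
    hh.isEmbedding.comp (isEmbedding_prodMkLeft c)
  have hmem : ∀ x : manifoldBoundary n M, h (x, c) ∈ U := fun x ↦ hU fun hx ↦ by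
    have : (x, c) ∈ h ⁻¹' manifoldBoundary n M := hx
    rw [hh.preimage_eq] at this
    exact hc this
  have := (hslice.codRestrict U hmem).secondCountableTopology
  exact isLindelof_iff_lindelofSpace.2 inferInstance

theorem metrizableSpace_of_isLindelof (hM : IsManifoldWithBoundary n M)
    (hL : IsLindelof (univ : Set M)) : TopologicalSpace.MetrizableSpace M := by
  have := hM.t2
  have := hM.weaklyLocallyCompactSpace
  obtain ⟨U, -, hU, hU2⟩ := hL.exists_isOpen_secondCountable hM.exists_isOpen_secondCountable
  have : SecondCountableTopology M :=
    (IsEmbedding.id.codRestrict U fun x ↦ hU (mem_univ x)).secondCountableTopology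
  infer_instance

theorem isLindelof_manifoldBoundary_of_metrizableSpace [PreconnectedSpace M]
    (hM : IsManifoldWithBoundary n M) (hmet : TopologicalSpace.MetrizableSpace M) :
    IsLindelof (manifoldBoundary n M) := by
  have := hM.weaklyLocallyCompactSpace
  let _ := TopologicalSpace.metrizableSpaceMetric M
  have := sigmaCompactSpace_of_preconnectedSpace M
  exact (isClosed_manifoldBoundary n M).isLindelof

theorem isCountablyMetacompact_manifoldBoundary (hM : IsManifoldWithBoundary n M)
    (h : TopologicalSpace.MetrizableSpace ↥(manifoldBoundary n M) ∨
      IsLindelof (manifoldBoundary n M)) :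
    IsCountablyMetacompact ↥(manifoldBoundary n M) := by
  rcases h with h | h
  · let _ := TopologicalSpace.metrizableSpaceMetric ↥(manifoldBoundary n M)
    exact ParacompactSpace.isCountablyMetacompact
  · have := hM.t2
    have := hM.weaklyLocallyCompactSpace
    obtain ⟨U, -, hU, hU2⟩ := h.exists_isOpen_secondCountable hM.exists_isOpen_secondCountable
    have : SecondCountableTopology (manifoldBoundary n M) :=
      (IsEmbedding.inclusion hU).secondCountableTopology
    have := (isClosed_manifoldBoundary n M).locallyCompactSpace
    exact ParacompactSpace.isCountablyMetacompact

end IsManifoldWithBoundary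

theorem theorem1p2 (n : ℕ) (M : Type*) [TopologicalSpace M] [ConnectedSpace M]
    (hM : IsManifoldWithBoundary n M) :
    -- (a)
    (IsCompact (manifoldBoundary n M) → IsStronglyCollared (manifoldBoundary n M)) ∧
    -- (b)
    (IsLindelof (manifoldBoundary n M) → IsCollared (manifoldBoundary n M)) ∧
    -- (c)
    (TopologicalSpace.MetrizableSpace ↥(manifoldBoundary n M)ᶜ → IsCollared (manifoldBoundary n M) →
      IsLindelof (manifoldBoundary n M)) ∧
    -- (d), with the two special cases of countable metacompactness that it names
    ((NormalSpace M → IsCountablyMetacompact ↥(manifoldBoundary n M) →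
        IsCollared (manifoldBoundary n M) → IsStronglyCollared (manifoldBoundary n M)) ∧
      (TopologicalSpace.MetrizableSpace ↥(manifoldBoundary n M) ∨ IsLindelof (manifoldBoundary n M) →
        IsCountablyMetacompact ↥(manifoldBoundary n M))) ∧
    -- (e)
    (TopologicalSpace.MetrizableSpace ↥(manifoldBoundary n M)ᶜ →
      (IsCollared (manifoldBoundary n M) ↔ IsStronglyCollared (manifoldBoundary n M)) ∧
      (IsStronglyCollared (manifoldBoundary n M) ↔ TopologicalSpace.MetrizableSpace M)) := by
  have hclosed := isClosed_manifoldBoundary n M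
  have hmetrizable : TopologicalSpace.MetrizableSpace ↥(manifoldBoundary n M)ᶜ →
      IsCollared (manifoldBoundary n M) → TopologicalSpace.MetrizableSpace M := fun hmet hc ↦ by
    have hint := hM.isLindelof_compl_manifoldBoundary hmet
    have hL := (hM.isLindelof_manifoldBoundary_of_isCollared hint hc).union hint
    rw [union_compl_self] at hL
    exact hM.metrizableSpace_of_isLindelof hL
  have hstrong : TopologicalSpace.MetrizableSpace M → IsStronglyCollared (manifoldBoundary n M) :=
    fun hmet ↦ by
      have hL := hM.isLindelof_manifoldBoundary_of_metrizableSpace hmet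
      let _ := TopologicalSpace.metrizableSpaceMetric M
      exact (hM.isCollared_of_isLindelof hL).isStronglyCollared hclosed
        (hM.isCountablyMetacompact_manifoldBoundary (Or.inr hL))
  have hweak : IsStronglyCollared (manifoldBoundary n M) → IsCollared (manifoldBoundary n M) :=
    fun ⟨h, hh, _⟩ ↦ ⟨h, hh⟩
  refine ⟨fun hK ↦ ?_, hM.isCollared_of_isLindelof, fun hmet hc ↦ ?_,
    ⟨fun _ hm hc ↦ hc.isStronglyCollared hclosed hm, hM.isCountablyMetacompact_manifoldBoundary⟩,
    fun hmet ↦ ⟨⟨fun hc ↦ hstrong (hmetrizable hmet hc), hweak⟩,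
      fun hs ↦ hmetrizable hmet (hweak hs), hstrong⟩⟩
  · -- A collar of a compact boundary is a map from a compact space to a Hausdorff space.
    have := hM.t2
    have := isCompact_iff_compactSpace.1 hK
    obtain ⟨h, hh⟩ := hM.isCollared_of_isLindelof hK.isLindelof
    exact ⟨h, hh, hh.isEmbedding.continuous.isClosedMap⟩
  · exact hM.isLindelof_manifoldBoundary_of_isCollared
      (hM.isLindelof_compl_manifoldBoundary hmet) hc
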